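/- **Conventions.** A circuit on Boolean variables $x_1,\dots,x_n$ is a finite directed acyclic graph whose nodes are input variables, Boolean constants, NOT gates, and AND and OR gates of unbounded fan-in, with one designated output node. Its size is the total number of its nodes (the gates together with the input variables and constants occurring in it), and its depth is the largest number of AND and OR gates on a path to the output (NOT gates are free). $\mathrm{AC}^0(s,d)$ denotes the class of circuits of size at most $s$ and depth at most $d$. For $P\in\mathbb{R}[x_1,\dots,x_n]$ put $\|P\|_\infty=\max_{a\in\{0,1\}^n}|P(a)|$. All logarithms are to base $2$. For $\varepsilon>0$, an *$\varepsilon$-error probabilistic polynomial with witness* ($\varepsilon$-error PPW) for a circuit $C(x_1,\dots,x_n)$ is a pair $(\mathbf P,\mathbf E)$ of jointly distributed (discrete) random variables, where $\mathbf P$ takes values in $\mathbb{R}[x_1,\dots,x_n]$ and $\mathbf E$ takes values in the circuits on $x_1,\dots,x_n$, such that for every $a\in\{0,1\}^n$ * $\Pr[\mathbf E(a)=1]\le\varepsilon$, and * for every $(P,E)$ in the support of $(\mathbf P,\mathbf E)$: if $E(a)=0$, then $P(a)=C(a)$. **Lemma.** There is an absolute constant $c\in\mathbb{N}$ such that the following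 holds for all $n,s,d\in\mathbb{N}$ with $s\ge 2$ and all $0<\varepsilon\le 1$. Every circuit $C\in\mathrm{AC}^0(s,d)$ on $n$ variables has an $\varepsilon$-error PPW $(\mathbf P,\mathbf E)$ such that every $(P,E)$ in its support satisfies * $\deg P\le(\log s)^{c d}\cdot\log(1/\varepsilon)$, * $\|P\|_\infty\le\exp\!\big((\log s)^{c d}\cdot\log(1/\varepsilon)\big)$, * $E\in\mathrm{AC}^0\big((s\cdot\max\{1,\log(1/\varepsilon)\})^{c},\,d+c\big)$. In particular, for $\varepsilon\le 1/2$ the size of $E$ is at most $(s\log(1/\varepsilon))^{c}$. -/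

import Mathlib

/-- A node of a Boolean circuit on the input variables `x_0, …, x_{n-1}`, of which `m` nodes precede
it: an input variable, a Boolean constant, a negation, or an AND or OR of unbounded fan-in. The
wires entering a gate come from earlier nodes. -/
inductive Gate (n m : ℕ) : Type where
  | var (i : Fin n) : Gate n m
  | const (b : Bool) : Gate n m
  | not (j : Fin m) : Gate n m
  | and (S : Finset (Fin m)) : Gate n m
  | or (S : Finset (Fin m)) : Gate n m

/-- The bit computed by a node on the input `a`, given the bits `v` computed by the earlier nodes. -/
def Gate.eval {n m : ℕ} (a : Fin n → Bool) (v : Fin m → Bool) : Gate n m → Bool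
  | .var i => a i
  | .const b => b
  | .not j => !(v j)
  | .and S => decide (∀ j ∈ S, v j = true)
  | .or S => decide (∃ j ∈ S, v j = true)

/-- The depth of a node, given the depths `h` of the earlier nodes: AND and OR gates are counted,
negations are free, input nodes have depth `0`. -/
def Gate.depth {n m : ℕ} (h : Fin m → ℕ) : Gate n m → ℕ
  | .var _ => 0
  | .const _ => 0
  | .not j => h j
  | .and S => S.sup h + 1
  | .or S => S.sup h + 1

/-- A Boolean circuit on `n` input variables: a finite directed acyclic graph, given in topological
order, with arbitrary fan-out. The size is the number of all nodes: the AND, OR and NOT gates, and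
also the input variables and the constants that occur in the circuit. -/
structure Circuit (n : ℕ) : Type where
  size : ℕ
  gate : (k : Fin size) → Gate n k
  output : Fin size

namespace Circuit

variable {n : ℕ}

/-- The bit computed by node `k` of the circuit on the input `a`. -/
def value (C : Circuit n) (a : Fin n → Bool) (k : Fin C.size) : Bool :=
  (C.gate k).eval a (fun j => C.value a ⟨j, j.2.trans k.2⟩)
termination_by k.val
decreasing_by exact j.2

/-- The Boolean function `C(a)` computed by the circuit. -/
def eval (C : Circuit n) (a : Fin n → Bool) : Bool := C.value a C.output

/-- The depth of node `k`: the largest number of AND and OR gates on a path that ends in `k`. -/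
def nodeDepth (C : Circuit n) (k : Fin C.size) : ℕ :=
  (C.gate k).depth (fun j => C.nodeDepth ⟨j, j.2.trans k.2⟩)
termination_by k.val
decreasing_by exact j.2

/-- The depth of the circuit: the largest number of AND and OR gates on a path to the output. -/
def depth (C : Circuit n) : ℕ := C.nodeDepth C.output

end Circuit

/-- The class `AC⁰(s, d)` of circuits of size at most `s` and depth at most `d`. -/
def AC0 (n s d : ℕ) : Set (Circuit n) := {C | C.size ≤ s ∧ C.depth ≤ d}

/-- The real number `0` or `1` that a bit stands for. -/
def bit (b : Bool) : ℝ := if b then 1 else 0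

/-- The value `P(a)` of a real polynomial at a point `a` of the Boolean cube. -/
noncomputable def evalCube {n : ℕ} (P : MvPolynomial (Fin n) ℝ) (a : Fin n → Bool) : ℝ :=
  MvPolynomial.eval (fun i => bit (a i)) P

/-- `‖P‖_∞ = max_{a ∈ {0,1}ⁿ} |P(a)|`. -/
noncomputable def cubeNorm {n : ℕ} (P : MvPolynomial (Fin n) ℝ) : ℝ :=
  ⨆ a : Fin n → Bool, |evalCube P a|

/-- `μ`, the joint law of a pair (random polynomial, random circuit), is an `ε`-error probabilistic
polynomial with witness for the circuit `C`: on every input the random circuit outputs `1` with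
probability at most `ε`, and for every pair in the support of `μ` and every input on which the
circuit outputs `0`, the polynomial agrees with `C`. -/
def IsPPW {n : ℕ} (C : Circuit n) (ε : ℝ)
    (μ : PMF (MvPolynomial (Fin n) ℝ × Circuit n)) : Prop :=
  (∀ a : Fin n → Bool,
    μ.toOuterMeasure {x | x.2.eval a = true} ≤ ENNReal.ofReal ε) ∧
  ∀ x ∈ μ.support, ∀ a : Fin n → Bool,
    x.2.eval a = false → evalCube x.1 a = bit (C.eval a)

/-! On a fixed input, call an input of an OR (AND) gate active if it is 1 (0). If some member of a
family of R sets contains exactly one active input, then the product, over the family, of one minus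
the sum of the active bits in the set equals their NOR. Random sets of the densities 2^(-j-2), a few
of each, isolate an active input at every gate simultaneously except with probability polynomially
small in s, and R = O((log s)^2) sets suffice (`prob_forall_not_isolated`). Composing along the
circuit gives degree R^d (`exists_norPoly`, `exists_nodePoly`). Failure of isolation can be read off
the values at the nodes of C by a circuit of constant extra depth and polynomial size
(`cost_exists_bad`); this is the witness of a single sample.

Pushing this error down to ε directly would put log(1/ε) into R, hence to the power d into the
degree. Instead, each sample keeps error 2^(-4t) with t about log s, and l = ⌈log(1/ε)⌉ independent
samples are combined by the multilinear majority polynomial (`exists_majorityPoly`), which only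
multiplies the degree by l. The combined witness has to fire whenever at most half of the samples
are good. Exact majority is not available in constant depth, but an AND-OR-AND approximate majority
is enough (`exists_approxMajority`): if it fires, more than a 1/(2t) fraction of the samples is bad,
which has probability at most 2^(-l) (`prob_many_le`).

Extreme parameters are treated apart: a random constant for ε ≥ 1/2, and an exact polynomial with a
witness that never fires if one of degree at most log(1/ε) exists. What remains has log(1/ε) < s, s
≥ 3 and d ≥ 1, so that constants are absorbed into powers of log s and the witness has size
polynomial in s alone (`exists_isPPW_of_lt`). -/

/-- The probability of `p` under the uniform distribution on a finite type. -/
noncomputable def prob {A : Type*} [Fintype A] (p : A → Prop) : ℝ :=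
  (Nat.card {x // p x} : ℝ) / Fintype.card A

/-! ### Uniform probability on finite types -/

section prob

variable {A ι : Type*} [Fintype A]

theorem prob_eq (p : A → Prop) [DecidablePred p] :
    prob p = ((Finset.univ.filter p).card : ℝ) / Fintype.card A := by
  rw [prob, Nat.card_eq_fintype_card, Fintype.card_subtype]

theorem prob_nonneg (p : A → Prop) : 0 ≤ prob p := by
  unfold prob; positivity

theorem prob_mono {p q : A → Prop} (h : ∀ x, p x → q x) : prob p ≤ prob q := by
  classical
  rw [prob_eq, prob_eq]
  gcongr
  exact fun hx => h _ hx

theorem prob_true [Nonempty A] : prob (fun _ : A => True) = 1 := by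
  classical
  rw [prob_eq]
  simp

theorem prob_not [Nonempty A] (p : A → Prop) : prob (fun x => ¬ p x) = 1 - prob p := by
  classical
  rw [prob_eq, prob_eq, eq_sub_iff_add_eq, ← add_div, div_eq_one_iff_eq (by simp)]
  have := Finset.card_filter_add_card_filter_not (s := (Finset.univ : Finset A)) p
  rw [add_comm, ← Finset.card_univ]
  exact_mod_cast this

theorem prob_exists_le [Fintype ι] (p : ι → A → Prop) :
    prob (fun x => ∃ i, p i x) ≤ ∑ i, prob (p i) := by
  classical
  simp only [prob_eq]
  rw [← Finset.sum_div]
  gcongr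
  have : Finset.univ.filter (fun x => ∃ i, p i x) =
      Finset.univ.biUnion fun i => Finset.univ.filter (p i) := by
    ext; simp
  rw [this]
  exact_mod_cast Finset.card_biUnion_le

theorem sum_prob_le_prob_exists (s : Finset ι) (p : ι → A → Prop)
    (h : ∀ i ∈ s, ∀ j ∈ s, ∀ x, p i x → p j x → i = j) :
    ∑ i ∈ s, prob (p i) ≤ prob (fun x => ∃ i ∈ s, p i x) := by
  classical
  simp only [prob_eq]
  rw [← Finset.sum_div]
  gcongr
  have : Finset.univ.filter (fun x => ∃ i ∈ s, p i x) =
      s.biUnion fun i => Finset.univ.filter (p i) := by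
    ext; simp
  rw [this, Finset.card_biUnion]
  · push_cast; rfl
  · intro i hi j hj hij
    refine Finset.disjoint_left.2 fun x hx hx' => hij ?_
    simp only [Finset.mem_filter, Finset.mem_univ, true_and] at hx hx'
    exact h i hi j hj x hx hx'

theorem prob_or_le (p q : A → Prop) : prob (fun x => p x ∨ q x) ≤ prob p + prob q := by
  classical
  simp only [prob_eq]
  rw [← add_div]
  gcongr
  rw [Finset.filter_or]
  exact_mod_cast Finset.card_union_le _ _

theorem prob_pi [Fintype ι] [DecidableEq ι] (p : ι → A → Prop) :
    prob (fun x : ι → A => ∀ i, p i (x i)) = ∏ i, prob (p i) := by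
  classical
  simp only [prob_eq]
  rw [Finset.prod_div_distrib]
  have : Finset.univ.filter (fun x : ι → A => ∀ i, p i (x i)) =
      Fintype.piFinset fun i => Finset.univ.filter (p i) := by
    ext; simp
  rw [this, Fintype.card_piFinset]
  simp

theorem prob_pi_const [Fintype ι] [DecidableEq ι] (p : A → Prop) :
    prob (fun x : ι → A => ∀ i, p (x i)) = prob p ^ Fintype.card ι := by
  rw [prob_pi fun _ => p]; simp

theorem prob_pi_mem [Fintype ι] [DecidableEq ι] [Nonempty A] (s : Finset ι) (p : A → Prop) :
    prob (fun x : ι → A => ∀ i ∈ s, p (x i)) = prob p ^ s.card := by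
  rw [prob_pi fun i y => i ∈ s → p y, ← Finset.prod_const, ← Finset.prod_subset s.subset_univ]
  · refine Finset.prod_congr rfl fun i hi => ?_
    simp [hi]
  · intro i _ hi
    simp [hi, prob_true]

theorem prob_apply [Fintype ι] [DecidableEq ι] [Nonempty A] (i : ι) (p : A → Prop) :
    prob (fun x : ι → A => p (x i)) = prob p := by
  simpa using prob_pi_mem {i} p

theorem exists_of_prob_lt_one [Nonempty A] {p : A → Prop} (h : prob p < 1) : ∃ x, ¬ p x := by
  by_contra! H
  have : p = fun _ => True := funext fun x => by simp [H x]
  rw [this, prob_true] at h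
  exact lt_irrefl _ h

end prob

/-! ### Isolation by random sets -/

/-- A random set that contains every point independently with probability `2 ^ (-j-2)` meets a set
with between `2 ^ j` and `2 ^ (j + 1)` elements in exactly one point with probability at
least `1 / 8`. -/
theorem prob_existsUnique_lt {m k j : ℕ} (hj : j ≤ k) (T : Finset (Fin m))
    (h₁ : 2 ^ j ≤ T.card) (h₂ : T.card < 2 ^ (j + 1)) :
    1 / 8 ≤ prob fun h : Fin m → Fin (2 ^ (k + 2)) =>
      ∃ i ∈ T, (h i : ℕ) < 2 ^ (k - j) ∧ ∀ i' ∈ T, (h i' : ℕ) < 2 ^ (k - j) → i' = i := by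
  set q : ℝ := 1 / 2 ^ (j + 2) with hq
  -- Thresholding one uniform variable at 2^(k-j) gives density 2^(-j-2), so a single table of
  -- samples serves all scales.
  have hlo : prob (fun y : Fin (2 ^ (k + 2)) => (y : ℕ) < 2 ^ (k - j)) = q := by
    classical
    rw [prob_eq]
    have : (Finset.univ.filter fun y : Fin (2 ^ (k + 2)) => (y : ℕ) < 2 ^ (k - j)).card
        = 2 ^ (k - j) := by
      rw [Fin.card_filter_val_lt, min_eq_right]
      exact Nat.pow_le_pow_right (by norm_num) (by omega)
    rw [this, Fintype.card_fin, hq]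
    push_cast
    rw [div_eq_div_iff (by positivity) (by positivity), one_mul, ← pow_add]
    congr 1; omega
  have hhi : prob (fun y : Fin (2 ^ (k + 2)) => ¬ (y : ℕ) < 2 ^ (k - j)) = 1 - q := by
    rw [prob_not, hlo]
  have key := sum_prob_le_prob_exists T (fun i (h : Fin m → Fin (2 ^ (k + 2))) =>
    (h i : ℕ) < 2 ^ (k - j) ∧ ∀ i' ∈ T, (h i' : ℕ) < 2 ^ (k - j) → i' = i)
    (fun i hi i' hi' x hx hx' => hx'.2 i hi hx.1)
  refine le_trans ?_ key
  have hterm : ∀ i ∈ T, prob (fun h : Fin m → Fin (2 ^ (k + 2)) =>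
      (h i : ℕ) < 2 ^ (k - j) ∧ ∀ i' ∈ T, (h i' : ℕ) < 2 ^ (k - j) → i' = i)
      = q * (1 - q) ^ (T.card - 1) := by
    intro i hi
    -- One condition per coordinate, so that `prob_pi` applies: coordinates of T other than i must
    -- miss the threshold, those outside T are free.
    have e : (fun h : Fin m → Fin (2 ^ (k + 2)) =>
        (h i : ℕ) < 2 ^ (k - j) ∧ ∀ i' ∈ T, (h i' : ℕ) < 2 ^ (k - j) → i' = i) =
        fun h => ∀ i', (fun i' (y : Fin (2 ^ (k + 2))) =>
          if i' = i then (y : ℕ) < 2 ^ (k - j) else i' ∈ T → ¬ (y : ℕ) < 2 ^ (k - j)) i' (h i') := by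
      funext h
      refine propext ⟨fun H i' => ?_, fun H => ⟨by simpa using H i, fun i' hi' hlt => ?_⟩⟩
      · by_cases hii : i' = i
        · subst hii; simpa using H.1
        · simpa [hii] using fun hi' => not_lt.1 fun hlt => hii (H.2 i' hi' hlt)
      · by_contra hii
        have := H i'
        simp only [hii, if_false] at this
        exact this hi' hlt
    rw [e, prob_pi (fun i' (y : Fin (2 ^ (k + 2))) =>
      if i' = i then (y : ℕ) < 2 ^ (k - j) else i' ∈ T → ¬ (y : ℕ) < 2 ^ (k - j)), ← Finset.prod_subset T.subset_univ, ← Finset.mul_prod_erase T _ hi]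
    · congr 1
      · simpa using hlo
      · rw [← Finset.card_erase_of_mem hi, ← Finset.prod_const]
        refine Finset.prod_congr rfl fun i' hi' => ?_
        have := Finset.mem_erase.1 hi'
        simpa only [this.1, this.2, if_false, forall_const] using hhi
    · intro i' _ hi'
      have : i' ≠ i := fun hh => hi' (hh ▸ hi)
      simp only [this, if_false, hi', false_imp_iff, prob_true]
  rw [Finset.sum_congr rfl hterm, Finset.sum_const, nsmul_eq_mul]
  -- The upper bound keeps (1 - q)^(#T - 1) above 1/2 by Bernoulli; the lower bound 1/4 on the same
  -- product then leaves 1/4 · 1/2 in the sum.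
  have hTq : (T.card : ℝ) * q ≤ 1 / 2 := by
    have : (T.card : ℝ) ≤ 2 ^ (j + 1) := by exact_mod_cast h₂.le
    rw [hq, mul_one_div, div_le_iff₀ (by positivity)]
    rw [pow_succ _ (j + 1)]; linarith
  have hTq' : 1 / 4 ≤ (T.card : ℝ) * q := by
    have : (2 : ℝ) ^ j ≤ T.card := by exact_mod_cast h₁
    rw [hq, mul_one_div, le_div_iff₀ (by positivity), pow_add]
    linarith
  have hq0 : 0 ≤ q := by positivity
  have hq1 : q ≤ 1 := by
    rw [hq, div_le_one (by positivity)]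
    exact one_le_pow₀ (by norm_num)
  have hbern : 1 / 2 ≤ (1 - q) ^ (T.card - 1) := by
    have := one_add_mul_le_pow (a := -q) (by linarith) (T.card - 1)
    rw [← sub_eq_add_neg] at this
    refine le_trans ?_ this
    have : ((T.card - 1 : ℕ) : ℝ) ≤ T.card := by exact_mod_cast Nat.sub_le _ _
    nlinarith
  nlinarith

/-- The scales `2 ^ (-j-2)` for `j ≤ k` together isolate a point of every nonempty `T` of size at
most `2 ^ k`, except with probability `(7 / 8) ^ r` when `r` independent samples are taken. -/
theorem prob_forall_not_isolated {m k r : ℕ} (hm : m ≤ 2 ^ k) (T : Finset (Fin m))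
    (hT : T.Nonempty) :
    prob (fun h : Fin r → Fin m → Fin (2 ^ (k + 2)) => ∀ ρ, ∀ j : Fin (k + 1),
      ¬ ∃ i ∈ T, (h ρ i : ℕ) < 2 ^ (k - j) ∧ ∀ i' ∈ T, (h ρ i' : ℕ) < 2 ^ (k - j) → i' = i)
      ≤ (7 / 8) ^ r := by
  rw [prob_pi_const (fun h : Fin m → Fin (2 ^ (k + 2)) => ∀ j : Fin (k + 1),
      ¬ ∃ i ∈ T, (h i : ℕ) < 2 ^ (k - j) ∧ ∀ i' ∈ T, (h i' : ℕ) < 2 ^ (k - j) → i' = i),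
    Fintype.card_fin]
  refine pow_le_pow_left₀ (prob_nonneg _) ?_ _
  have hle : T.card ≤ 2 ^ k := (Finset.card_le_univ T).trans (by simpa using hm)
  have h0 : T.card ≠ 0 := hT.card_pos.ne'
  -- Only the scale matching the size of T is used; the others are there because T is unknown when
  -- the sets are drawn.
  have hj : Nat.log 2 T.card ≤ k := by
    rw [← Nat.log_pow (b := 2) (by norm_num) k]
    exact Nat.log_mono_right hle
  have := prob_existsUnique_lt hj T (Nat.pow_log_le_self 2 h0)
    (Nat.lt_pow_succ_log_self (by norm_num) _)
  have h' : prob (fun h : Fin m → Fin (2 ^ (k + 2)) => ∀ j : Fin (k + 1),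
      ¬ ∃ i ∈ T, (h i : ℕ) < 2 ^ (k - j) ∧ ∀ i' ∈ T, (h i' : ℕ) < 2 ^ (k - j) → i' = i) ≤ _ :=
    prob_mono fun h H => H ⟨Nat.log 2 T.card, by omega⟩
  rw [prob_not] at h'
  simp only at h'
  linarith

/-! ### Many samples and approximate majority -/

/-- If a bad event has probability at most `2 ^ (-4t)`, then more than a `1 / (2t)` fraction of `l`
independent copies is bad with probability at most `2 ^ (-l)`. -/
theorem prob_many_le {A : Type*} [Fintype A] [Nonempty A] (p : A → Prop) [DecidablePred p]
    {t : ℕ} (l : ℕ) (hp : prob p ≤ (1 / 2) ^ (4 * t)) :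
    prob (fun x : Fin l → A => l < 2 * t * (Finset.univ.filter fun i => p (x i)).card)
      ≤ (1 / 2) ^ l := by
  have h1 : prob (fun x : Fin l → A => l < 2 * t * (Finset.univ.filter fun i => p (x i)).card) ≤
      prob (fun x : Fin l → A => ∃ Z : Finset (Fin l), l < 2 * t * Z.card ∧ ∀ i ∈ Z, p (x i)) :=
    prob_mono fun x hx => ⟨_, hx, fun i hi => (Finset.mem_filter.1 hi).2⟩
  refine h1.trans ((prob_exists_le _).trans ?_)
  -- The bound 2^(-2l) per set Z leaves room for the union bound over all 2^l sets.
  have h2 : ∀ Z : Finset (Fin l),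
      prob (fun x : Fin l → A => l < 2 * t * Z.card ∧ ∀ i ∈ Z, p (x i)) ≤ (1 / 2) ^ (2 * l) := by
    intro Z
    by_cases hZ : l < 2 * t * Z.card
    · simp only [hZ, true_and]
      rw [prob_pi_mem]
      calc prob p ^ Z.card ≤ ((1 / 2) ^ (4 * t)) ^ Z.card :=
            pow_le_pow_left₀ (prob_nonneg _) hp _
        _ = (1 / 2) ^ (4 * t * Z.card) := by rw [← pow_mul]
        _ ≤ (1 / 2) ^ (2 * l) :=
            pow_le_pow_of_le_one (by norm_num) (by norm_num) (by nlinarith)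
    · simp only [hZ, false_and]
      have : prob (fun _ : Fin l → A => False) = 0 := by simp [prob]
      rw [this]; positivity
  refine (Finset.sum_le_sum fun Z _ => h2 Z).trans ?_
  rw [Finset.sum_const, Finset.card_univ, Fintype.card_finset, Fintype.card_fin, nsmul_eq_mul,
    two_mul, pow_add]
  push_cast
  rw [← mul_assoc, ← mul_pow]
  norm_num

/-- Monotone AND-OR-AND formulas over `l` bits that separate the inputs with at most half ones from
those with at most a `1 / (2t)` fraction of zeros. -/
theorem exists_approxMajority {l t : ℕ} (hl : 0 < l) (ht : 2 * (2 * l + 4) ≤ 2 ^ t) :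
    ∃ idx : Fin (l + 2) → Fin (2 * l + 4) → Fin t → Fin l, ∀ G : Finset (Fin l),
      (2 * G.card ≤ l → ¬ ∀ x, ∃ y, ∀ z, idx x y z ∈ G) ∧
      (2 * t * Gᶜ.card ≤ l → ∀ x, ∃ y, ∀ z, idx x y z ∈ G) := by
  have : Nonempty (Fin l) := ⟨⟨0, hl⟩⟩
  have hmem : ∀ G : Finset (Fin l), prob (fun i => i ∈ G) = (G.card : ℝ) / l := by
    intro G
    classical
    rw [prob_eq]; simp
  have hl' : (0 : ℝ) < l := by exact_mod_cast hl
  let Bad : Finset (Fin l) → (Fin (l + 2) → Fin (2 * l + 4) → Fin t → Fin l) → Prop :=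
    fun G idx => (2 * G.card ≤ l ∧ ∀ x, ∃ y, ∀ z, idx x y z ∈ G) ∨
      (2 * t * Gᶜ.card ≤ l ∧ ∃ x, ∀ y, ∃ z, idx x y z ∉ G)
  have hfalse : prob (fun _ : Fin (l + 2) → Fin (2 * l + 4) → Fin t → Fin l => False) = 0 := by
    simp [prob]
  have hBad : ∀ G, prob (Bad G) ≤ (1 / 2) ^ (l + 1) * (3 / 4) := by
    intro G
    -- Each inner AND holds with probability at most 2^(-t), so each OR with probability at most
    -- (2l+4) 2^(-t) ≤ 1/2; the l + 2 ORs are independent.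
    have hA : prob (fun idx : Fin (l + 2) → Fin (2 * l + 4) → Fin t → Fin l =>
        2 * G.card ≤ l ∧ ∀ x, ∃ y, ∀ z, idx x y z ∈ G) ≤ (1 / 2) ^ (l + 2) := by
      by_cases hG : 2 * G.card ≤ l
      · simp only [hG, true_and]
        rw [prob_pi_const (fun f : Fin (2 * l + 4) → Fin t → Fin l => ∃ y, ∀ z, f y z ∈ G),
          Fintype.card_fin]
        refine pow_le_pow_left₀ (prob_nonneg _) ((prob_exists_le _).trans ?_) _
        have h1 : ∀ y : Fin (2 * l + 4),
            prob (fun f : Fin (2 * l + 4) → Fin t → Fin l => ∀ z, f y z ∈ G) ≤ (1 / 2) ^ t := by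
          intro y
          rw [prob_apply y (fun g : Fin t → Fin l => ∀ z, g z ∈ G),
            prob_pi_const (fun i => i ∈ G), Fintype.card_fin]
          refine pow_le_pow_left₀ (prob_nonneg _) ?_ _
          rw [hmem, div_le_iff₀ hl']
          have : (2 * G.card : ℝ) ≤ l := by exact_mod_cast hG
          linarith
        refine (Finset.sum_le_sum fun y _ => h1 y).trans ?_
        rw [Finset.sum_const, Finset.card_univ, Fintype.card_fin, nsmul_eq_mul]
        have : (2 * ((2 * l + 4 : ℕ) : ℝ)) ≤ 2 ^ t := by exact_mod_cast ht
        rw [one_div, inv_pow, ← div_eq_mul_inv, div_le_iff₀ (by positivity)]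
        linarith
      · simp only [hG, false_and, hfalse]; positivity
    -- Each inner AND fails with probability at most t · #Gᶜ / l ≤ 1/2, so each OR fails with
    -- probability at most 2^(-(2l+4)).
    have hB : prob (fun idx : Fin (l + 2) → Fin (2 * l + 4) → Fin t → Fin l =>
        2 * t * Gᶜ.card ≤ l ∧ ∃ x, ∀ y, ∃ z, idx x y z ∉ G) ≤ (1 / 2) ^ (l + 2) / 2 := by
      by_cases hG : 2 * t * Gᶜ.card ≤ l
      · simp only [hG, true_and]
        refine (prob_exists_le _).trans ?_
        have h1 : ∀ x : Fin (l + 2),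
            prob (fun idx : Fin (l + 2) → Fin (2 * l + 4) → Fin t → Fin l =>
              ∀ y, ∃ z, idx x y z ∉ G) ≤ (1 / 2) ^ (2 * l + 4) := by
          intro x
          rw [prob_apply x (fun f : Fin (2 * l + 4) → Fin t → Fin l => ∀ y, ∃ z, f y z ∉ G),
            prob_pi_const (fun g : Fin t → Fin l => ∃ z, g z ∉ G), Fintype.card_fin]
          refine pow_le_pow_left₀ (prob_nonneg _) ((prob_exists_le _).trans ?_) _
          have h2 : ∀ z : Fin t, prob (fun g : Fin t → Fin l => g z ∉ G) = (Gᶜ.card : ℝ) / l := by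
            intro z
            rw [prob_apply z (fun i => i ∉ G), ← hmem]
            simp
          rw [Finset.sum_congr rfl fun z _ => h2 z, Finset.sum_const, Finset.card_univ,
            Fintype.card_fin, nsmul_eq_mul, ← mul_div_assoc, div_le_iff₀ hl']
          have : (2 * t * Gᶜ.card : ℝ) ≤ l := by exact_mod_cast hG
          linarith
        refine (Finset.sum_le_sum fun x _ => h1 x).trans ?_
        rw [Finset.sum_const, Finset.card_univ, Fintype.card_fin, nsmul_eq_mul]
        have h3 : ((l + 2 : ℕ) : ℝ) ≤ 2 ^ l * 2 := by
          have : l + 1 ≤ 2 ^ l := Nat.lt_two_pow_self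
          have : l + 2 ≤ 2 ^ l * 2 := by omega
          exact_mod_cast this
        calc ((l + 2 : ℕ) : ℝ) * (1 / 2) ^ (2 * l + 4)
            ≤ (2 ^ l * 2) * (1 / 2) ^ (2 * l + 4) := by gcongr
          _ = (2 ^ l * (1 / 2) ^ l) * ((1 / 2) ^ (l + 2)) / 2 := by ring
          _ = (1 / 2) ^ (l + 2) / 2 := by rw [← mul_pow]; norm_num
      · simp only [hG, false_and, hfalse]; positivity
    refine (prob_or_le _ _).trans ((add_le_add hA hB).trans ?_)
    rw [pow_succ _ (l + 1)]
    linarith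
  -- Probabilistic method: the union bound over all 2^l inputs G totals at most 3/8, so some wiring
  -- works for every G.
  have hlt : prob (fun idx => ∃ G, Bad G idx) < 1 := by
    refine (prob_exists_le Bad).trans_lt ((Finset.sum_le_sum fun G _ => hBad G).trans_lt ?_)
    rw [Finset.sum_const, Finset.card_univ, Fintype.card_finset, Fintype.card_fin, nsmul_eq_mul,
      pow_succ]
    push_cast
    rw [← mul_assoc, ← mul_assoc, ← mul_pow]
    norm_num
  obtain ⟨idx, h⟩ := exists_of_prob_lt_one hlt
  refine ⟨idx, fun G => ⟨fun hG H => h ⟨G, Or.inl ⟨hG, H⟩⟩, fun hG => ?_⟩⟩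
  by_contra! H
  exact h ⟨G, Or.inr ⟨hG, H⟩⟩

/-! ### Extending circuits and counting the added nodes -/

namespace Circuit

variable {n : ℕ}

/-- Some node of `C` of depth at most `D` decides the property `p` of the input. -/
def Computes (C : Circuit n) (D : ℕ) (p : (Fin n → Bool) → Prop) : Prop :=
  ∃ k : Fin C.size, (∀ a, C.value a k = true ↔ p a) ∧ C.nodeDepth k ≤ D

/-- Everything that is computed by a node of `C` is computed by a node of `C'`. -/
def Extends (C C' : Circuit n) : Prop :=
  ∀ D p, C.Computes D p → C'.Computes D p

theorem Extends.refl (C : Circuit n) : C.Extends C := fun _ _ h => h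

theorem Extends.trans {C C' C'' : Circuit n} (h : C.Extends C') (h' : C'.Extends C'') :
    C.Extends C'' := fun D p hp => h' D p (h D p hp)

theorem Computes.mono {C : Circuit n} {D D' : ℕ} {p : (Fin n → Bool) → Prop}
    (h : C.Computes D p) (hD : D ≤ D') : C.Computes D' p :=
  let ⟨k, hk, hd⟩ := h
  ⟨k, hk, hd.trans hD⟩

/-- The circuit `C` with a further node added after its nodes. -/
abbrev snoc (C : Circuit n) (g : Gate n C.size) : Circuit n where
  size := C.size + 1
  gate k := if h : (k : ℕ) < C.size then C.gate ⟨k, h⟩ else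
    (show C.size = k by omega) ▸ g
  output := Fin.last _

theorem snoc_gate_castSucc (C : Circuit n) (g : Gate n C.size) (k : Fin C.size) :
    (C.snoc g).gate k.castSucc = C.gate k := by
  simp [snoc]

theorem snoc_gate_last (C : Circuit n) (g : Gate n C.size) :
    (C.snoc g).gate (Fin.last C.size) = g := by
  simp [snoc]

theorem snoc_value_castSucc (C : Circuit n) (g : Gate n C.size) (a : Fin n → Bool)
    (k : Fin C.size) : (C.snoc g).value a k.castSucc = C.value a k := by
  obtain ⟨k, hk⟩ := k
  induction k using Nat.strong_induction_on with
  | _ k ih =>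
    rw [value.eq_1 (C.snoc g), value.eq_1 C, snoc_gate_castSucc]
    congr 1
    funext j
    exact ih j j.2 _

theorem snoc_nodeDepth_castSucc (C : Circuit n) (g : Gate n C.size)
    (k : Fin C.size) : (C.snoc g).nodeDepth k.castSucc = C.nodeDepth k := by
  obtain ⟨k, hk⟩ := k
  induction k using Nat.strong_induction_on with
  | _ k ih =>
    rw [nodeDepth.eq_1 (C.snoc g), nodeDepth.eq_1 C, snoc_gate_castSucc]
    congr 1
    funext j
    exact ih j j.2 _

theorem snoc_value_last (C : Circuit n) (g : Gate n C.size) (a : Fin n → Bool) :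
    (C.snoc g).value a (Fin.last C.size) = g.eval a (C.value a) := by
  rw [value.eq_1 (C.snoc g), snoc_gate_last]
  congr 1
  funext j
  exact C.snoc_value_castSucc g a j

theorem snoc_nodeDepth_last (C : Circuit n) (g : Gate n C.size) :
    (C.snoc g).nodeDepth (Fin.last C.size) = g.depth C.nodeDepth := by
  rw [nodeDepth.eq_1 (C.snoc g), snoc_gate_last]
  congr 1
  funext j
  exact C.snoc_nodeDepth_castSucc g j

theorem extends_snoc (C : Circuit n) (g : Gate n C.size) : C.Extends (C.snoc g) := by
  rintro D p ⟨k, hk, hd⟩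
  refine ⟨k.castSucc, fun a => ?_, ?_⟩
  · rw [snoc_value_castSucc, hk]
  · rwa [snoc_nodeDepth_castSucc]

/-- With `σ` further nodes, any circuit that extends `C` can be made to compute `p` in
depth `D`. -/
def Cost (C : Circuit n) (σ D : ℕ) (p : (Fin n → Bool) → Prop) : Prop :=
  ∀ C', C.Extends C' → ∃ C'', C'.Extends C'' ∧ C''.size ≤ C'.size + σ ∧ C''.Computes D p

variable {C : Circuit n} {σ D : ℕ}

theorem Computes.cost {p : (Fin n → Bool) → Prop} (h : C.Computes D p) : C.Cost 0 D p :=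
  fun C' hC' => ⟨C', .refl _, le_rfl, hC' _ _ h⟩

theorem Cost.mono {σ' D' : ℕ} {p : (Fin n → Bool) → Prop} (h : C.Cost σ D p)
    (hσ : σ ≤ σ') (hD : D ≤ D') : C.Cost σ' D' p := fun C' hC' =>
  let ⟨C'', h₁, h₂, h₃⟩ := h C' hC'
  ⟨C'', h₁, h₂.trans (by omega), h₃.mono hD⟩

theorem Cost.congr {p q : (Fin n → Bool) → Prop} (h : C.Cost σ D p) (hpq : ∀ a, p a ↔ q a) :
    C.Cost σ D q := by
  rwa [← funext fun a => propext (hpq a)]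

theorem Cost.not {p : (Fin n → Bool) → Prop} (h : C.Cost σ D p) :
    C.Cost (σ + 1) D fun a => ¬ p a := by
  intro C' hC'
  obtain ⟨C'', h₁, h₂, k, hk, hd⟩ := h C' hC'
  refine ⟨C''.snoc (.not k), h₁.trans (extends_snoc _ _), ?_, Fin.last _, fun a => ?_, ?_⟩
  · change C''.size + 1 ≤ _
    omega
  · rw [snoc_value_last]
    simp [Gate.eval, ← hk a]
  · rw [snoc_nodeDepth_last]
    exact hd

/-- The members are added one after another; this is possible because `Cost` quantifies over all
extensions of C and earlier results survive later ones. -/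
theorem Cost.family {ι : Type*} {p : ι → (Fin n → Bool) → Prop} (s : Finset ι)
    (h : ∀ i ∈ s, C.Cost σ D (p i)) (C' : Circuit n) (hC' : C.Extends C') :
    ∃ C'', C'.Extends C'' ∧ C''.size ≤ C'.size + s.card * σ ∧
      ∀ i ∈ s, C''.Computes D (p i) := by
  classical
  induction s using Finset.induction_on with
  | empty => exact ⟨C', .refl _, by simp, by simp⟩
  | insert i s hi ih =>
    obtain ⟨C₁, h₁, h₂, h₃⟩ := ih fun j hj => h j (Finset.mem_insert_of_mem hj)
    obtain ⟨C₂, h₄, h₅, h₆⟩ := h i (Finset.mem_insert_self _ _) C₁ (hC'.trans h₁)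
    refine ⟨C₂, h₁.trans h₄, ?_, ?_⟩
    · rw [Finset.card_insert_of_notMem hi, add_mul]
      omega
    · intro j hj
      obtain rfl | hj := Finset.mem_insert.1 hj
      · exact h₆
      · exact h₄ _ _ (h₃ j hj)

theorem Cost.forall {ι : Type*} [Fintype ι] {p : ι → (Fin n → Bool) → Prop}
    (h : ∀ i, C.Cost σ D (p i)) :
    C.Cost (Fintype.card ι * σ + 1) (D + 1) fun a => ∀ i, p i a := by
  intro C' hC'
  obtain ⟨C'', h₁, h₂, h₃⟩ := Cost.family Finset.univ (fun i _ => h i) C' hC'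
  choose k hk hd using fun i => h₃ i (Finset.mem_univ i)
  classical
  refine ⟨C''.snoc (.and (Finset.univ.image k)), h₁.trans (extends_snoc _ _), ?_, Fin.last _,
    fun a => ?_, ?_⟩
  · change C''.size + 1 ≤ _
    rw [Finset.card_univ] at h₂
    omega
  · rw [snoc_value_last]
    simp [Gate.eval, hk]
  · rw [snoc_nodeDepth_last]
    simpa [Gate.depth] using hd

theorem Cost.exists {ι : Type*} [Fintype ι] {p : ι → (Fin n → Bool) → Prop}
    (h : ∀ i, C.Cost σ D (p i)) :
    C.Cost (Fintype.card ι * σ + 1) (D + 1) fun a => ∃ i, p i a := by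
  intro C' hC'
  obtain ⟨C'', h₁, h₂, h₃⟩ := Cost.family Finset.univ (fun i _ => h i) C' hC'
  choose k hk hd using fun i => h₃ i (Finset.mem_univ i)
  classical
  refine ⟨C''.snoc (.or (Finset.univ.image k)), h₁.trans (extends_snoc _ _), ?_, Fin.last _,
    fun a => ?_, ?_⟩
  · change C''.size + 1 ≤ _
    rw [Finset.card_univ] at h₂
    omega
  · rw [snoc_value_last]
    simp [Gate.eval, hk]
  · rw [snoc_nodeDepth_last]
    simpa [Gate.depth] using hd

theorem Cost.and {p q : (Fin n → Bool) → Prop} (hp : C.Cost σ D p) (hq : C.Cost σ D q) :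
    C.Cost (2 * σ + 1) (D + 1) fun a => p a ∧ q a := by
  have := Cost.forall (ι := Bool) (p := fun b a => if b then p a else q a) (σ := σ) (D := D)
    (C := C) (by rintro (_ | _) <;> simpa)
  exact (this.congr fun a => by simp [and_comm]).mono (by simp) le_rfl

/-- A constant costs one node. -/
theorem cost_const (b : Prop) : C.Cost 1 (D + 1) fun _ => b := by
  -- The constants are realised as the empty AND and the empty OR, which explains the depth D + 1.
  by_cases hb : b
  · exact (Cost.forall (C := C) (ι := Empty) (p := fun _ _ => False) (σ := 0) (D := D)
      (fun i => i.elim)).congr fun a => by simp [hb]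
  · exact (Cost.exists (C := C) (ι := Empty) (p := fun _ _ => False) (σ := 0) (D := D)
      (fun i => i.elim)).congr fun a => by simp [hb]

/-- The truth of b is known when the circuit is built. This restricts a conjunction to a sampled set
without any circuitry for membership. -/
theorem Cost.imp_const {p : (Fin n → Bool) → Prop} (h : C.Cost σ (D + 1) p) (b : Prop) :
    C.Cost (σ + 1) (D + 1) fun a => b → p a := by
  by_cases hb : b
  · exact (h.congr fun a => by simp [hb]).mono (by omega) le_rfl
  · exact ((cost_const True).congr fun a => by simp [hb]).mono (by omega) le_rfl

theorem value_withOutput (C : Circuit n) (o : Fin C.size) (a : Fin n → Bool) (k : Fin C.size) :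
    Circuit.value { C with output := o } a k = C.value a k := by
  obtain ⟨k, hk⟩ := k
  induction k using Nat.strong_induction_on with
  | _ k ih =>
    rw [value.eq_1 { C with output := o }, value.eq_1 C]
    congr 1
    funext j
    exact ih j j.2 _

theorem nodeDepth_withOutput (C : Circuit n) (o : Fin C.size) (k : Fin C.size) :
    Circuit.nodeDepth { C with output := o } k = C.nodeDepth k := by
  obtain ⟨k, hk⟩ := k
  induction k using Nat.strong_induction_on with
  | _ k ih =>
    rw [nodeDepth.eq_1 { C with output := o }, nodeDepth.eq_1 C]
    congr 1
    funext j
    exact ih j j.2 _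

/-- A property of cost `σ` over `C` is the one decided by a circuit with `σ` more nodes. -/
theorem Cost.exists_circuit {p : (Fin n → Bool) → Prop} (h : C.Cost σ D p) :
    ∃ E ∈ AC0 n (C.size + σ) D, ∀ a, E.eval a = true ↔ p a := by
  obtain ⟨C', -, hs, k, hk, hd⟩ := h C (.refl C)
  refine ⟨{ C' with output := k }, ⟨hs, ?_⟩, fun a => ?_⟩
  · exact (nodeDepth_withOutput C' k k).trans_le hd
  · rw [← hk a, ← value_withOutput C' k a k, eval]

end Circuit

/-! ### Polynomials for NOR, majority and functions of few variables -/

open MvPolynomial in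
/-- The polynomial `∏ κ, (1 - ∑ j ∈ T κ, p j)` agrees with the NOR of the `p j`, provided that some
`T κ` isolates a true input whenever there is one. -/
theorem exists_norPoly {n : ℕ} {J K : Type*} [Fintype K] (S : Finset J) (T : K → Finset J)
    (hT : ∀ κ, T κ ⊆ S) (p : J → MvPolynomial (Fin n) ℝ) {D : ℕ} {B : ℝ} (hB : 0 ≤ B)
    (hD : ∀ j ∈ S, (p j).totalDegree ≤ D) (hp : ∀ j ∈ S, ∀ a, |evalCube (p j) a| ≤ B) :
    ∃ q : MvPolynomial (Fin n) ℝ, q.totalDegree ≤ Fintype.card K * D ∧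
      (∀ a, |evalCube q a| ≤ (1 + S.card * B) ^ Fintype.card K) ∧
      ∀ a, ∀ b : J → Bool, (∀ j ∈ S, evalCube (p j) a = bit (b j)) →
        ((∃ j ∈ S, b j = true) →
          ∃ κ, ∃ i ∈ T κ, b i = true ∧ ∀ i' ∈ T κ, b i' = true → i' = i) →
        evalCube q a = bit (!decide (∃ j ∈ S, b j = true)) := by
  have heval : ∀ a, evalCube (∏ κ, (1 - ∑ j ∈ T κ, p j)) a =
      ∏ κ, (1 - ∑ j ∈ T κ, evalCube (p j) a) := by
    intro a
    simp [evalCube, map_prod, map_sum]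
  refine ⟨∏ κ, (1 - ∑ j ∈ T κ, p j), ?_, fun a => ?_, fun a b hb hiso => ?_⟩
  · refine (totalDegree_finsetProd _ _).trans ?_
    rw [← smul_eq_mul, ← Finset.card_univ, ← Finset.sum_const]
    refine Finset.sum_le_sum fun κ _ => (totalDegree_sub _ _).trans (max_le (by simp) ?_)
    exact totalDegree_finsetSum_le fun j hj => hD j (hT κ hj)
  · rw [heval, Finset.abs_prod, ← Finset.card_univ, ← Finset.prod_const]
    refine Finset.prod_le_prod (fun _ _ => abs_nonneg _) fun κ _ => ?_
    refine (abs_sub _ _).trans ?_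
    rw [abs_one]
    gcongr
    refine (Finset.abs_sum_le_sum_abs _ _).trans
      ((Finset.sum_le_sum fun j hj => hp j (hT κ hj) a).trans ?_)
    rw [Finset.sum_const, nsmul_eq_mul]
    gcongr
    exact hT κ
  · rw [heval]
    by_cases h : ∃ j ∈ S, b j = true
    · obtain ⟨κ, i, hi, hbi, huniq⟩ := hiso h
      rw [decide_eq_true h]
      refine (Finset.prod_eq_zero (Finset.mem_univ κ) ?_).trans (by simp [bit])
      rw [Finset.sum_eq_single_of_mem i hi, hb i (hT κ hi), hbi]
      · simp [bit]
      · intro j hj hji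
        rw [hb j (hT κ hj)]
        have : b j ≠ true := fun hbj => hji (huniq j hj hbj)
        simp [bit, this]
    · rw [decide_eq_false h]
      refine (Finset.prod_eq_one fun κ _ => ?_).trans (by simp [bit])
      rw [Finset.sum_eq_zero, sub_zero]
      intro j hj
      rw [hb j (hT κ hj)]
      have : b j ≠ true := fun hbj => h ⟨j, hT κ hj, hbj⟩
      simp [bit, this]

open MvPolynomial in
/-- The multilinear extension of the majority function, applied to polynomials: where more than half
of them take the same Boolean value, so does the result. -/
theorem exists_majorityPoly {n l : ℕ} (y : Fin l → MvPolynomial (Fin n) ℝ) {D : ℕ} {B : ℝ}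
    (hB : 0 ≤ B) (hD : ∀ i, (y i).totalDegree ≤ D) (hy : ∀ i a, |evalCube (y i) a| ≤ B)
    (hy' : ∀ i a, |1 - evalCube (y i) a| ≤ B) :
    ∃ M : MvPolynomial (Fin n) ℝ, M.totalDegree ≤ l * D ∧
      (∀ a, |evalCube M a| ≤ (2 * B) ^ l) ∧
      ∀ a b, ∀ G : Finset (Fin l), (∀ i ∈ G, evalCube (y i) a = bit b) → l < 2 * G.card →
        evalCube M a = bit b := by
  classical
  let M : MvPolynomial (Fin n) ℝ := ∑ T : Finset (Fin l),
    if l < 2 * T.card then (∏ i ∈ T, y i) * ∏ i ∈ Tᶜ, (1 - y i) else 0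
  let τ : (Fin n → Bool) → Finset (Fin l) → ℝ := fun a T =>
    (∏ i ∈ T, evalCube (y i) a) * ∏ i ∈ Tᶜ, (1 - evalCube (y i) a)
  have heval : ∀ a, evalCube M a = ∑ T, if l < 2 * T.card then τ a T else 0 := by
    intro a
    simp only [M, τ, evalCube, map_sum]
    refine Finset.sum_congr rfl fun T _ => ?_
    split_ifs <;> simp [map_prod]
  -- Expand the product of the factors y i + (1 - y i) = 1.
  have hsum : ∀ a, ∑ T, τ a T = 1 := by
    intro a
    have := Finset.prod_add (fun i => evalCube (y i) a) (fun i => 1 - evalCube (y i) a)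
      (Finset.univ : Finset (Fin l))
    simp only [add_sub_cancel, Finset.prod_const_one, Finset.powerset_univ,
      ← Finset.compl_eq_univ_sdiff] at this
    exact this.symm
  refine ⟨M, ?_, fun a => ?_, fun a b G hG hcard => ?_⟩
  · refine totalDegree_finsetSum_le fun T _ => ?_
    split_ifs
    · refine (totalDegree_mul _ _).trans ?_
      have h1 : (∏ i ∈ T, y i).totalDegree ≤ T.card * D := by
        refine (totalDegree_finsetProd _ _).trans ?_
        exact (Finset.sum_le_card_nsmul _ _ _ fun i _ => hD i)
      have h2 : (∏ i ∈ Tᶜ, (1 - y i)).totalDegree ≤ Tᶜ.card * D := by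
        refine (totalDegree_finsetProd _ _).trans ?_
        refine (Finset.sum_le_card_nsmul _ _ _ fun i _ => (totalDegree_sub _ _).trans ?_)
        exact max_le (by simp) (hD i)
      refine (add_le_add h1 h2).trans ?_
      rw [← add_mul, Finset.card_add_card_compl, Fintype.card_fin]
    · simp
  · rw [heval]
    have hτ : ∀ T, |τ a T| ≤ B ^ l := by
      intro T
      rw [abs_mul, Finset.abs_prod, Finset.abs_prod]
      have h1 : ∏ i ∈ T, |evalCube (y i) a| ≤ B ^ T.card := by
        rw [← Finset.prod_const]
        exact Finset.prod_le_prod (fun _ _ => abs_nonneg _) fun i _ => hy i a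
      have h2 : ∏ i ∈ Tᶜ, |1 - evalCube (y i) a| ≤ B ^ Tᶜ.card := by
        rw [← Finset.prod_const]
        exact Finset.prod_le_prod (fun _ _ => abs_nonneg _) fun i _ => hy' i a
      calc _ ≤ B ^ T.card * B ^ Tᶜ.card := by gcongr
        _ = B ^ l := by rw [← pow_add, Finset.card_add_card_compl, Fintype.card_fin]
    refine (Finset.abs_sum_le_sum_abs _ _).trans
      ((Finset.sum_le_card_nsmul _ _ (B ^ l) fun T _ => ?_).trans ?_)
    · split_ifs
      · exact hτ T
      · rw [abs_zero]; positivity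
    · rw [Finset.card_univ, Fintype.card_finset, Fintype.card_fin, nsmul_eq_mul, mul_pow]
      push_cast; rfl
  · rw [heval]
    cases b with
    | true =>
      -- Compare with the sum over all T: a T that is not a majority omits some i in G, and its term
      -- contains the factor 1 - 1 = 0.
      rw [← (hsum a).trans (by simp [bit] : (1 : ℝ) = bit true)]
      refine Finset.sum_congr rfl fun T _ => ?_
      split_ifs with hT
      · rfl
      · obtain ⟨i, hi, hiT⟩ : ∃ i ∈ G, i ∉ T :=
          Finset.not_subset.1 fun hGT => hT (by have := Finset.card_le_card hGT; omega)
        refine (mul_eq_zero_of_right _ (Finset.prod_eq_zero (Finset.mem_compl.2 hiT) ?_)).symm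
        rw [hG i hi]; simp [bit]
    | false =>
      refine (Finset.sum_eq_zero fun T _ => ?_).trans (by simp [bit] : (0 : ℝ) = bit false)
      split_ifs with hT
      · obtain ⟨i, hi, hiT⟩ : ∃ i ∈ G, i ∈ T := by
          by_contra! H
          have h1 : G ⊆ Tᶜ := fun i hi => Finset.mem_compl.2 (H i hi)
          have h2 := Finset.card_le_card h1
          have h3 := Finset.card_add_card_compl T
          rw [Fintype.card_fin] at h3
          omega
        refine mul_eq_zero_of_left (Finset.prod_eq_zero hiT ?_) _
        rw [hG i hi]; simp [bit]
      · rfl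

open MvPolynomial in
/-- A Boolean function of the variables in `W` is a polynomial of degree at most `#W` on the
cube. -/
theorem exists_poly_of_dependsOn {n : ℕ} (W : Finset (Fin n)) (f : (Fin n → Bool) → Bool)
    (hf : ∀ a a', (∀ i ∈ W, a i = a' i) → f a = f a') :
    ∃ p : MvPolynomial (Fin n) ℝ, p.totalDegree ≤ W.card ∧ ∀ a, evalCube p a = bit (f a) := by
  induction W using Finset.induction_on generalizing f with
  | empty =>
    refine ⟨C (bit (f fun _ => false)), by simp, fun a => ?_⟩
    rw [hf a (fun _ => false) (by simp)]
    simp [evalCube]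
  | insert i W hi ih =>
    have key : ∀ b : Bool, ∃ p : MvPolynomial (Fin n) ℝ, p.totalDegree ≤ W.card ∧
        ∀ a, evalCube p a = bit (f (Function.update a i b)) := by
      intro b
      refine ih (fun a => f (Function.update a i b)) fun a a' h => hf _ _ fun j hj => ?_
      obtain rfl | hj := Finset.mem_insert.1 hj
      · simp
      · have : j ≠ i := fun hji => hi (hji ▸ hj)
        simp [this, h j hj]
    obtain ⟨p₁, hd₁, h₁⟩ := key true
    obtain ⟨p₀, hd₀, h₀⟩ := key false
    -- Shannon expansion in the variable i.
    refine ⟨X i * p₁ + (1 - X i) * p₀, ?_, fun a => ?_⟩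
    · rw [Finset.card_insert_of_notMem hi]
      refine (totalDegree_add _ _).trans (max_le ?_ ?_)
      · refine (totalDegree_mul _ _).trans ?_
        rw [totalDegree_X]; omega
      · refine (totalDegree_mul _ _).trans ?_
        have : (1 - X i : MvPolynomial (Fin n) ℝ).totalDegree ≤ 1 :=
          (totalDegree_sub _ _).trans (by simp)
        omega
    · have e : evalCube (X i * p₁ + (1 - X i) * p₀) a =
          bit (a i) * evalCube p₁ a + (1 - bit (a i)) * evalCube p₀ a := by
        simp [evalCube]
      rw [e, h₁, h₀]
      cases hai : a i with
      | true =>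
        have : Function.update a i true = a := by rw [← hai, Function.update_eq_self]
        rw [this]; simp [bit]
      | false =>
        have : Function.update a i false = a := by rw [← hai, Function.update_eq_self]
        rw [this]; simp [bit]

/-! ### Exact polynomials, and polynomials correct where isolation succeeds -/

/-- The variable that occurs at a node, if any. -/
def Gate.vars {n m : ℕ} : Gate n m → Finset (Fin n)
  | .var i => {i}
  | _ => ∅

namespace Circuit

variable {n : ℕ} (C : Circuit n)

theorem value_congr {a a' : Fin n → Bool} (k : Fin C.size)
    (h : ∀ u ≤ k, ∀ i ∈ (C.gate u).vars, a i = a' i) : C.value a k = C.value a' k := by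
  obtain ⟨k, hk⟩ := k
  induction k using Nat.strong_induction_on with
  | _ k ih =>
    have hv : (fun j : Fin k => C.value a ⟨j, j.2.trans hk⟩) =
        fun j : Fin k => C.value a' ⟨j, j.2.trans hk⟩ := by
      funext j
      exact ih j j.2 _ fun u hu => h u (hu.trans (Fin.mk_le_mk.2 j.2.le))
    have hk' := h ⟨k, hk⟩ le_rfl
    rw [value.eq_1 C a, value.eq_1 C a']
    simp only
    rw [hv]
    cases hg : C.gate ⟨k, hk⟩ with
    | var i => exact hk' i (by rw [hg]; simp [Gate.vars])
    | const b => rfl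
    | not j => rfl
    | and S => rfl
    | or S => rfl

/-- Every circuit is computed exactly by a polynomial whose degree is at most the number of its
variables. -/
theorem exists_exactPoly : ∃ p : MvPolynomial (Fin n) ℝ, p.totalDegree ≤ max 1 (C.size - 1) ∧
    ∀ a, evalCube p a = bit (C.eval a) := by
  by_cases hg : ∃ i, C.gate C.output = .var i
  · obtain ⟨i, hi⟩ := hg
    refine ⟨.X i, by simp, fun a => ?_⟩
    rw [eval, value.eq_1, hi]
    simp [evalCube, Gate.eval]
  -- The output node contributes no variable, which saves one in the degree; the saving later
  -- excludes s = 2.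
  · have hout : (C.gate C.output).vars = ∅ := by
      cases h : C.gate C.output with
      | var i => exact absurd ⟨i, h⟩ hg
      | _ => rfl
    obtain ⟨p, hd, hp⟩ := exists_poly_of_dependsOn
      ((Finset.Iio C.output).biUnion fun u => (C.gate u).vars) C.eval fun a a' h => by
        refine C.value_congr _ fun u hu i hi => h i ?_
        refine Finset.mem_biUnion.2 ⟨u, Finset.mem_Iio.2 (lt_of_le_of_ne hu ?_), hi⟩
        rintro rfl
        simp [hout] at hi
    refine ⟨p, hd.trans (le_max_of_le_right (Finset.card_biUnion_le.trans ?_)), hp⟩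
    refine (Finset.sum_le_card_nsmul _ _ 1 fun u _ => ?_).trans ?_
    · cases C.gate u <;> simp [Gate.vars]
    · rw [Fin.card_Iio]
      have := C.output.2
      simp only [smul_eq_mul, mul_one]
      omega

/-- The inputs of an OR gate `v` that are `1`, or the inputs of an AND gate `v` that are `0`: those
that determine the value of `v` on their own. -/
def Active (a : Fin n → Bool) (v j : Fin C.size) : Prop :=
  (∃ S, C.gate v = .or S ∧ (∃ h : j < v, (⟨j, h⟩ : Fin v) ∈ S) ∧ C.value a j = true) ∨
  (∃ S, C.gate v = .and S ∧ (∃ h : j < v, (⟨j, h⟩ : Fin v) ∈ S) ∧ C.value a j = false)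

/-- The gate `v` has active inputs on `a`, but none of the sets `{i | 𝒮 κ i}` contains exactly one
of them. -/
def Bad {K : Type*} (𝒮 : K → Fin C.size → Prop) (a : Fin n → Bool) (v : Fin C.size) : Prop :=
  (∃ j, C.Active a v j) ∧
    ∀ κ, ¬ ∃ i, (C.Active a v i ∧ 𝒮 κ i) ∧ ∀ i', 𝒮 κ i' ∧ i' ≠ i → ¬ C.Active a v i'

-- `Bad` is phrased as the witness circuit evaluates it, with the sampled sets entering only through
-- constants; this is the form that `exists_norPoly` asks for.
variable {C} in
theorem exists_isolated {K : Type*} {𝒮 : K → Fin C.size → Prop} {a : Fin n → Bool}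
    {v : Fin C.size} (h : ¬ C.Bad 𝒮 a v) (hj : ∃ j, C.Active a v j) :
    ∃ κ i, C.Active a v i ∧ 𝒮 κ i ∧ ∀ i', 𝒮 κ i' → C.Active a v i' → i' = i := by
  by_contra! H
  refine h ⟨hj, fun κ ⟨i, ⟨h₁, h₂⟩, h₃⟩ => ?_⟩
  obtain ⟨i', h₄, h₅, h₆⟩ := H κ i h₁ h₂
  exact h₃ i' ⟨h₄, h₆⟩ h₅

/-- Since (2R)^h ≥ 1, the exponent (1 + (2R)^h) R is at most (2R)^(h+1): base 2R rather than R pays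
for the sum over the inputs. Bounds for q and 1 - q are carried together because negation exchanges
them. -/
theorem norm_step {R : ℕ} (hR : 0 < R) {s B q x : ℝ} (hs : 2 ≤ s) {h : ℕ}
    (hB : B = (2 * s) ^ (2 * R) ^ h) (hx0 : 0 ≤ x) (hx : x ≤ s) (hq : |q| ≤ (1 + x * B) ^ R) :
    |q| ≤ (2 * s) ^ (2 * R) ^ (h + 1) ∧ |1 - q| ≤ (2 * s) ^ (2 * R) ^ (h + 1) := by
  have hB1 : 1 ≤ B := hB ▸ one_le_pow₀ (by linarith)
  have h0 : 0 ≤ x * B := by positivity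
  have h1 : (1 + x * B) ^ R + 1 ≤ (2 * s) ^ (2 * R) ^ (h + 1) :=
    calc (1 + x * B) ^ R + 1 = (1 + x * B) ^ R + 1 ^ R := by rw [one_pow]
      _ ≤ (1 + x * B + 1) ^ R := pow_add_pow_le (by positivity) (by positivity) hR.ne'
      _ ≤ (2 * s * B) ^ R := by
        refine pow_le_pow_left₀ (by positivity) ?_ _
        nlinarith [mul_le_mul_of_nonneg_right hx (by linarith : 0 ≤ B)]
      _ = (2 * s) ^ ((1 + (2 * R) ^ h) * R) := by
        rw [hB, pow_mul, pow_add, pow_one]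
      _ ≤ (2 * s) ^ (2 * R) ^ (h + 1) := by
        refine pow_le_pow_right₀ (by linarith) ?_
        have : 1 ≤ (2 * R) ^ h := Nat.one_le_pow _ _ (by omega)
        rw [pow_succ]
        nlinarith
  constructor
  · linarith
  · refine (abs_sub _ _).trans ?_
    rw [abs_one]; linarith

/-- Every node has a polynomial of degree and norm bounded in terms of its depth that is correct
wherever no gate of that depth or less is bad. -/
theorem exists_nodePoly {K : Type*} [Fintype K] [Nonempty K] (𝒮 : K → Fin C.size → Prop) {s : ℕ}
    (hs : 2 ≤ s) (hC : C.size ≤ s) (v : Fin C.size) :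
    ∃ p : MvPolynomial (Fin n) ℝ,
      p.totalDegree ≤ Fintype.card K ^ C.nodeDepth v ∧
      (∀ a, |evalCube p a| ≤ (2 * s) ^ (2 * Fintype.card K) ^ C.nodeDepth v ∧
        |1 - evalCube p a| ≤ (2 * s) ^ (2 * Fintype.card K) ^ C.nodeDepth v) ∧
      ∀ a, (∀ u, C.nodeDepth u ≤ C.nodeDepth v → ¬ C.Bad 𝒮 a u) →
        evalCube p a = bit (C.value a v) := by
  classical
  have hs' : (2 : ℝ) ≤ s := by exact_mod_cast hs
  have hR : 0 < Fintype.card K := Fintype.card_pos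
  obtain ⟨v, hv⟩ := v
  induction v using Nat.strong_induction_on with
  | _ v ih =>
    have ih' : ∀ j : Fin v, _ := fun j => ih j j.2 (j.2.trans hv)
    choose p hdeg hnorm hcorr using ih'
    have hval := fun a => value.eq_1 C a ⟨v, hv⟩
    have hdep := nodeDepth.eq_1 C ⟨v, hv⟩
    have hone : ∀ h, (1 : ℝ) ≤ (2 * s) ^ (2 * Fintype.card K) ^ h :=
      fun h => one_le_pow₀ (by linarith)
    have hsub : ∀ (q : MvPolynomial (Fin n) ℝ) a, evalCube (1 - q) a = 1 - evalCube q a :=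
      fun q a => by simp [evalCube]
    have hdsub : ∀ q : MvPolynomial (Fin n) ℝ, (1 - q).totalDegree ≤ q.totalDegree :=
      fun q => (MvPolynomial.totalDegree_sub _ _).trans (by simp)
    have hscard : ∀ S : Finset (Fin v), (S.card : ℝ) ≤ s := fun S => by
      have := Finset.card_le_univ S
      rw [Fintype.card_fin] at this
      exact_mod_cast (this.trans hv.le).trans hC
    cases hg : C.gate ⟨v, hv⟩ with
    | var i =>
      rw [hg] at hdep
      refine ⟨.X i, by rw [MvPolynomial.totalDegree_X]; exact Nat.one_le_pow _ _ hR,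
        fun a => ?_, fun a _ => ?_⟩
      · have h : evalCube (.X i) a = bit (a i) := by simp [evalCube]
        rw [h]
        constructor <;> refine le_trans ?_ (hone _) <;> cases a i <;> simp [bit]
      · rw [hval, hg]; simp [evalCube, Gate.eval]
    | const b =>
      refine ⟨.C (bit b), by simp, fun a => ?_, fun a _ => ?_⟩
      · have h : evalCube (.C (bit b)) a = bit b := by simp [evalCube]
        rw [h]
        constructor <;> refine le_trans ?_ (hone _) <;> cases b <;> simp [bit]
      · rw [hval, hg]; simp [evalCube, Gate.eval]
    | not j =>
      rw [hg] at hdep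
      simp only [Gate.depth] at hdep
      rw [hdep]
      refine ⟨1 - p j, (hdsub _).trans (hdeg j), fun a => ?_, fun a ha => ?_⟩
      · rw [hsub, sub_sub_cancel]
        exact (hnorm j a).symm
      · rw [hsub, hcorr j a ha, hval, hg]
        simp only [Gate.eval]
        cases C.value a ⟨j, _⟩ <;> simp [bit]
    | or S =>
      rw [hg] at hdep
      simp only [Gate.depth] at hdep
      set H := S.sup fun j : Fin v => C.nodeDepth ⟨j, j.2.trans hv⟩
      have hle : ∀ j ∈ S, C.nodeDepth ⟨j, j.2.trans hv⟩ ≤ H := fun j hj =>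
        Finset.le_sup (f := fun j : Fin v => C.nodeDepth ⟨j, j.2.trans hv⟩) hj
      -- OR is one minus NOR.
      obtain ⟨q, hqd, hqn, hqc⟩ := exists_norPoly S
        (fun κ => S.filter fun j => 𝒮 κ ⟨j, j.2.trans hv⟩) (fun κ => Finset.filter_subset _ _) p
        (D := Fintype.card K ^ H) (B := (2 * s) ^ (2 * Fintype.card K) ^ H) (by positivity)
        (fun j hj => (hdeg j).trans (Nat.pow_le_pow_right hR (hle j hj)))
        (fun j hj a => (hnorm j a).1.trans (pow_le_pow_right₀ (by linarith)
          (Nat.pow_le_pow_right (by omega) (hle j hj))))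
      rw [hdep]
      refine ⟨1 - q, (hdsub _).trans (hqd.trans_eq (by rw [pow_succ, mul_comm])), fun a => ?_,
        fun a ha => ?_⟩
      · rw [hsub, sub_sub_cancel]
        exact (norm_step hR hs' rfl (by positivity) (hscard S) (hqn a)).symm
      · have hact : ∀ j : Fin C.size, C.Active a ⟨v, hv⟩ j ↔
            ∃ h : (j : ℕ) < v, (⟨j, h⟩ : Fin v) ∈ S ∧ C.value a j = true := by
          intro j
          simp only [Active, hg, Gate.or.injEq, exists_eq_left', reduceCtorEq, false_and,
            exists_false, or_false]
          exact ⟨fun ⟨⟨h, h'⟩, h''⟩ => ⟨h, h', h''⟩, fun ⟨h, h', h''⟩ => ⟨⟨h, h'⟩, h''⟩⟩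
        rw [hsub, hqc a (fun j => C.value a ⟨j, j.2.trans hv⟩)
          (fun j hj => hcorr j a fun u hu => ha u (hu.trans ((hle j hj).trans (Nat.le_succ _)))),
          hval, hg]
        · have hnot : ∀ b : Bool, 1 - bit (!b) = bit b := by rintro (_ | _) <;> simp [bit]
          rw [hnot]
          simp only [Gate.eval]
          congr
        · rintro ⟨j, hj, hvj⟩
          obtain ⟨κ, i, hi, hκi, huniq⟩ := exists_isolated (ha ⟨v, hv⟩ hdep.le)
            ⟨⟨j, j.2.trans hv⟩, (hact _).2 ⟨j.2, hj, hvj⟩⟩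
          obtain ⟨hiv, hiS, hi⟩ := (hact i).1 hi
          refine ⟨κ, ⟨i, hiv⟩, Finset.mem_filter.2 ⟨hiS, hκi⟩, hi, fun i' hi' hvi' => ?_⟩
          rw [Finset.mem_filter] at hi'
          have := huniq ⟨i', i'.2.trans hv⟩ hi'.2 ((hact _).2 ⟨i'.2, hi'.1, hvi'⟩)
          have := congrArg Fin.val this
          exact Fin.ext this
    | and S =>
      rw [hg] at hdep
      simp only [Gate.depth] at hdep
      set H := S.sup fun j : Fin v => C.nodeDepth ⟨j, j.2.trans hv⟩
      have hle : ∀ j ∈ S, C.nodeDepth ⟨j, j.2.trans hv⟩ ≤ H := fun j hj =>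
        Finset.le_sup (f := fun j : Fin v => C.nodeDepth ⟨j, j.2.trans hv⟩) hj
      -- AND is the NOR of the negated inputs, hence the use of the bound on 1 - p j.
      obtain ⟨q, hqd, hqn, hqc⟩ := exists_norPoly S
        (fun κ => S.filter fun j => 𝒮 κ ⟨j, j.2.trans hv⟩) (fun κ => Finset.filter_subset _ _)
        (fun j => 1 - p j)
        (D := Fintype.card K ^ H) (B := (2 * s) ^ (2 * Fintype.card K) ^ H) (by positivity)
        (fun j hj => (hdsub _).trans ((hdeg j).trans (Nat.pow_le_pow_right hR (hle j hj))))
        (fun j hj a => by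
          rw [hsub]
          exact (hnorm j a).2.trans (pow_le_pow_right₀ (by linarith)
            (Nat.pow_le_pow_right (by omega) (hle j hj))))
      rw [hdep]
      refine ⟨q, hqd.trans_eq (by rw [pow_succ, mul_comm]), fun a => ?_,
        fun a ha => ?_⟩
      · exact norm_step hR hs' rfl (by positivity) (hscard S) (hqn a)
      · have hact : ∀ j : Fin C.size, C.Active a ⟨v, hv⟩ j ↔
            ∃ h : (j : ℕ) < v, (⟨j, h⟩ : Fin v) ∈ S ∧ C.value a j = false := by
          intro j
          simp only [Active, hg, Gate.and.injEq, exists_eq_left', reduceCtorEq, false_and,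
            exists_false, false_or]
          exact ⟨fun ⟨⟨h, h'⟩, h''⟩ => ⟨h, h', h''⟩, fun ⟨h, h', h''⟩ => ⟨⟨h, h'⟩, h''⟩⟩
        rw [hqc a (fun j => !C.value a ⟨j, j.2.trans hv⟩) (fun j hj => by
            rw [hsub, hcorr j a fun u hu => ha u (hu.trans ((hle j hj).trans (Nat.le_succ _)))]
            cases C.value a ⟨j, _⟩ <;> simp [bit]),
          hval, hg]
        · simp only [Gate.eval]
          congr 1
          by_cases h : ∀ j ∈ S, C.value a ⟨j, j.2.trans hv⟩ = true
          · rw [decide_eq_true h]; simpa using h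
          · rw [decide_eq_false h]; simpa using h
        · rintro ⟨j, hj, hvj⟩
          obtain ⟨κ, i, hi, hκi, huniq⟩ := exists_isolated (ha ⟨v, hv⟩ hdep.le)
            ⟨⟨j, j.2.trans hv⟩, (hact _).2 ⟨j.2, hj, by simpa using hvj⟩⟩
          obtain ⟨hiv, hiS, hi⟩ := (hact i).1 hi
          refine ⟨κ, ⟨i, hiv⟩, Finset.mem_filter.2 ⟨hiS, hκi⟩, by simpa using hi,
            fun i' hi' hvi' => ?_⟩
          rw [Finset.mem_filter] at hi'
          have := huniq ⟨i', i'.2.trans hv⟩ hi'.2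
            ((hact _).2 ⟨i'.2, hi'.1, by simpa using hvi'⟩)
          have := congrArg Fin.val this
          exact Fin.ext this

end Circuit

/-! ### The witness circuit and the sampled pair -/

namespace Circuit

variable {n : ℕ} {C : Circuit n} {d : ℕ}

theorem computes_value {v : Fin C.size} (hv : C.nodeDepth v ≤ d) :
    C.Computes d fun a => C.value a v = true := ⟨v, fun _ => .rfl, hv⟩

/-- The wiring of C is fixed, so only the value at j is read, negated if v is an AND gate. A pair
that is not a wire costs a constant, and this accounts for depth d + 1. -/
theorem cost_active {v : Fin C.size} (hv : C.nodeDepth v ≤ d) (j : Fin C.size) :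
    C.Cost 1 (d + 1) fun a => C.Active a v j := by
  have hdep := nodeDepth.eq_1 C v
  have hfalse := cost_const (C := C) (D := d) False
  cases hg : C.gate v with
  | or S =>
    rw [hg] at hdep
    by_cases h : ∃ h : j < v, (⟨j, h⟩ : Fin v) ∈ S
    · obtain ⟨hjv, hjS⟩ := h
      have hle := Finset.le_sup (f := fun i : Fin v => C.nodeDepth ⟨i, i.2.trans v.2⟩) hjS
      simp only [Gate.depth] at hdep hle
      refine ((computes_value (v := j) (d := d) ?_).cost.mono (by omega) (by omega)).congr
        fun a => ?_
      · change C.nodeDepth j ≤ _ at hle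
        omega
      · exact ⟨fun h => Or.inl ⟨S, hg, ⟨hjv, hjS⟩, h⟩, by simp [Active, hg]⟩
    · exact hfalse.congr fun a => by simp [Active, hg, h]
  | and S =>
    rw [hg] at hdep
    by_cases h : ∃ h : j < v, (⟨j, h⟩ : Fin v) ∈ S
    · obtain ⟨hjv, hjS⟩ := h
      have hle := Finset.le_sup (f := fun i : Fin v => C.nodeDepth ⟨i, i.2.trans v.2⟩) hjS
      simp only [Gate.depth] at hdep hle
      refine ((computes_value (v := j) (d := d) ?_).cost.not.mono (by omega) (by omega)).congr
        fun a => ?_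
      · change C.nodeDepth j ≤ _ at hle
        omega
      · rw [Bool.not_eq_true]
        exact ⟨fun h => Or.inr ⟨S, hg, ⟨hjv, hjS⟩, h⟩, by simp [Active, hg]⟩
    · exact hfalse.congr fun a => by simp [Active, hg, h]
  | _ => exact hfalse.congr fun a => by simp [Active, hg]

/-- Only AND and OR gates have active inputs. -/
theorem Bad.nodeDepth_pos {K : Type*} {𝒮 : K → Fin C.size → Prop} {a : Fin n → Bool}
    {v : Fin C.size} (h : C.Bad 𝒮 a v) : 0 < C.nodeDepth v := by
  obtain ⟨⟨j, ⟨S, hS, -⟩ | ⟨S, hS, -⟩⟩, -⟩ := h <;>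
  · rw [nodeDepth.eq_1, hS]
    exact Nat.succ_pos _

theorem cost_bad {K : Type*} [Fintype K] [Nonempty K] (𝒮 : K → Fin C.size → Prop)
    {v : Fin C.size} (hv : C.nodeDepth v ≤ d) {s : ℕ} (hC : C.size ≤ s) :
    C.Cost (25 * Fintype.card K * s ^ 2) (d + 6) fun a => C.Bad 𝒮 a v := by
  have hs : 1 ≤ s := (Nat.succ_le_of_lt (Fin.pos v)).trans hC
  have hR : 1 ≤ Fintype.card K := Fintype.card_pos
  have huniq : ∀ κ (i : Fin C.size), C.Cost (3 * s + 1) (d + 2) fun a =>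
      ∀ i', 𝒮 κ i' ∧ i' ≠ i → ¬ C.Active a v i' := fun κ i =>
    (Cost.forall fun i' => (cost_active hv i').not.imp_const (𝒮 κ i' ∧ i' ≠ i)).mono
      (by rw [Fintype.card_fin]; nlinarith) le_rfl
  have hmem : ∀ κ (i : Fin C.size), C.Cost 3 (d + 2) fun a => C.Active a v i ∧ 𝒮 κ i :=
    fun κ i => (cost_active hv i).and (cost_const (𝒮 κ i))
  have hiso : ∀ κ, C.Cost (s * (6 * s + 3) + 2) (d + 4) fun a =>
      ¬ ∃ i, (C.Active a v i ∧ 𝒮 κ i) ∧ ∀ i', 𝒮 κ i' ∧ i' ≠ i → ¬ C.Active a v i' := fun κ =>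
    (Cost.exists fun i => ((hmem κ i).mono (by omega) le_rfl).and (huniq κ i)).not.mono
      (by rw [Fintype.card_fin]; nlinarith) le_rfl
  have hex : C.Cost (s + 1) (d + 2) fun a => ∃ j, C.Active a v j :=
    (Cost.exists fun j => cost_active hv j).mono (by rw [Fintype.card_fin]; omega) le_rfl
  have hss : s ≤ s ^ 2 := Nat.le_self_pow (by norm_num) s
  have hRs : s ^ 2 ≤ Fintype.card K * s ^ 2 := Nat.le_mul_of_pos_left _ hR
  have hbig : Fintype.card K * (s * (6 * s + 3) + 2) + 1 ≤ 12 * (Fintype.card K * s ^ 2) :=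
    calc Fintype.card K * (s * (6 * s + 3) + 2) + 1
        ≤ Fintype.card K * (11 * s ^ 2) + Fintype.card K * s ^ 2 := by
          refine add_le_add (Nat.mul_le_mul_left _ ?_) (by omega)
          nlinarith
      _ = _ := by ring
  refine ((hex.mono (by omega) (by omega)).and ((Cost.forall hiso).mono hbig le_rfl)).mono ?_ le_rfl
  have : 25 * Fintype.card K * s ^ 2 = 25 * (Fintype.card K * s ^ 2) := by ring
  omega

theorem cost_exists_bad {K : Type*} [Fintype K] [Nonempty K] (𝒮 : K → Fin C.size → Prop)
    (d : ℕ) {s : ℕ} (hC : C.size ≤ s) :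
    C.Cost (26 * Fintype.card K * s ^ 3) (d + 7) fun a =>
      ∃ v : {v // C.nodeDepth v ≤ d}, C.Bad 𝒮 a v := by
  have hs : 1 ≤ s := (Nat.succ_le_of_lt (Fin.pos C.output)).trans hC
  have hR : 1 ≤ Fintype.card K := Fintype.card_pos
  refine (Cost.exists fun v : {v // C.nodeDepth v ≤ d} => cost_bad 𝒮 v.2 hC).mono ?_ le_rfl
  have hcard : Fintype.card {v // C.nodeDepth v ≤ d} ≤ s :=
    ((Fintype.card_subtype_le _).trans_eq (Fintype.card_fin _)).trans hC
  have : 1 ≤ Fintype.card K * s ^ 3 := Nat.mul_pos hR (by positivity)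
  calc _ ≤ s * (25 * Fintype.card K * s ^ 2) + Fintype.card K * s ^ 3 := by gcongr
    _ = _ := by ring

/-- The scaled random sets given by a table of samples. -/
def sampleSet {m k r : ℕ} (h : Fin r → Fin m → Fin (2 ^ (k + 2))) (κ : Fin r × Fin (k + 1))
    (i : Fin m) : Prop := (h κ.1 i : ℕ) < 2 ^ (k - κ.2)

/-- The active inputs of v depend on a alone and not on the samples, so the isolation estimate
applies to them as a fixed set. -/
theorem prob_bad_le {k : ℕ} (hk : C.size ≤ 2 ^ k) (r : ℕ) (a : Fin n → Bool) (v : Fin C.size) :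
    prob (fun h : Fin r → Fin C.size → Fin (2 ^ (k + 2)) => C.Bad (sampleSet h) a v)
      ≤ (7 / 8) ^ r := by
  classical
  by_cases hT : ∃ j, C.Active a v j
  · refine (prob_mono fun h H ρ j => ?_).trans (prob_forall_not_isolated hk
      (Finset.univ.filter fun j => C.Active a v j) (by simpa [Finset.filter_nonempty_iff] using hT))
    rintro ⟨i, hi, h₁, h₂⟩
    refine H.2 (ρ, j) ⟨i, ⟨(Finset.mem_filter.1 hi).2, h₁⟩, fun i' ⟨h₃, h₄⟩ hi' => h₄ ?_⟩
    exact h₂ i' (by simpa using hi') h₃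
  · have : prob (fun h : Fin r → Fin C.size → Fin (2 ^ (k + 2)) => C.Bad (sampleSet h) a v) = 0 := by
      simp [prob, Bad, hT]
    rw [this]; positivity

theorem prob_exists_bad_le {k : ℕ} (hk : C.size ≤ 2 ^ k) (r : ℕ) (a : Fin n → Bool) (d : ℕ) :
    prob (fun h : Fin r → Fin C.size → Fin (2 ^ (k + 2)) =>
      ∃ v : {v // C.nodeDepth v ≤ d}, C.Bad (sampleSet h) a v) ≤ 2 ^ k * (7 / 8) ^ r := by
  refine (prob_exists_le _).trans ((Finset.sum_le_sum fun v _ => prob_bad_le hk r a v.1).trans ?_)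
  rw [Finset.sum_const, nsmul_eq_mul, Finset.card_univ]
  gcongr
  have : Fintype.card {v // C.nodeDepth v ≤ d} ≤ 2 ^ k :=
    ((Fintype.card_subtype_le _).trans_eq (Fintype.card_fin _)).trans hk
  exact_mod_cast this

/-- The majority of `l` independent samples, with an approximate majority of the individual
witnesses as its witness. -/
theorem exists_sampled_ppw {s k l t r : ℕ} (hs : 2 ≤ s) (hC : C.size ≤ s) (hd : C.depth ≤ d)
    (hk : s ≤ 2 ^ k) (hl : 0 < l) (ht : 2 * (2 * l + 4) ≤ 2 ^ t) (hr : 0 < r)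
    (hrt : (2 : ℝ) ^ k * (7 / 8) ^ r ≤ (1 / 2) ^ (4 * t)) :
    ∃ f : (Fin l → Fin r → Fin C.size → Fin (2 ^ (k + 2))) → MvPolynomial (Fin n) ℝ × Circuit n,
      (∀ a, prob (fun ω => (f ω).2.eval a = true) ≤ (1 / 2) ^ l) ∧
      (∀ ω a, (f ω).2.eval a = false → evalCube (f ω).1 a = bit (C.eval a)) ∧
      ∀ ω, (f ω).1.totalDegree ≤ l * (r * (k + 1)) ^ d ∧
        (∀ a, |evalCube (f ω).1 a| ≤ (2 * (2 * s) ^ (2 * (r * (k + 1))) ^ d) ^ l) ∧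
        (f ω).2 ∈ AC0 n
          (s + ((l + 2) * ((2 * l + 4) * (t * (27 * (r * (k + 1)) * s ^ 3) + 1) + 1) + 2))
          (d + 10) := by
  classical
  obtain ⟨idx, hidx⟩ := exists_approxMajority hl ht
  have : Nonempty (Fin r × Fin (k + 1)) := ⟨(⟨0, hr⟩, 0)⟩
  have hR : Fintype.card (Fin r × Fin (k + 1)) = r * (k + 1) := by simp
  have hRpos : 0 < r * (k + 1) := by positivity
  have hs1 : (2 : ℝ) ≤ s := by exact_mod_cast hs
  let Q : (Fin r → Fin C.size → Fin (2 ^ (k + 2))) → (Fin n → Bool) → Prop := fun h a =>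
    ∃ v : {v // C.nodeDepth v ≤ d}, C.Bad (sampleSet h) a v
  let G : (Fin l → Fin r → Fin C.size → Fin (2 ^ (k + 2))) → (Fin n → Bool) → Finset (Fin l) :=
    fun ω a => Finset.univ.filter fun i => ¬ Q (ω i) a
  have hE : ∀ ω, ∃ E ∈ AC0 n (C.size +
      ((l + 2) * ((2 * l + 4) * (t * (27 * (r * (k + 1)) * s ^ 3) + 1) + 1) + 2)) (d + 10),
      ∀ a, E.eval a = true ↔ ¬ ∀ x, ∃ y, ∀ z, idx x y z ∈ G ω a := by
    intro ω
    have h0 : ∀ i, C.Cost (27 * (r * (k + 1)) * s ^ 3) (d + 7) fun a => i ∈ G ω a := by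
      intro i
      refine ((cost_exists_bad (sampleSet (ω i)) d hC).not.mono ?_ le_rfl).congr fun a => ?_
      · rw [hR]
        have : 1 ≤ r * (k + 1) * s ^ 3 := Nat.mul_pos hRpos (by positivity)
        calc _ ≤ 26 * (r * (k + 1)) * s ^ 3 + r * (k + 1) * s ^ 3 := by gcongr
          _ = _ := by ring
      · simp [G, Q]
    refine (((Cost.forall fun x => Cost.exists fun y => Cost.forall fun z =>
      h0 (idx x y z)).not).mono ?_ le_rfl).exists_circuit
    simp only [Fintype.card_fin]
    exact le_rfl
  choose E hEmem hEeval using hE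
  choose p hpdeg hpnorm hpcorr using fun h : Fin r → Fin C.size → Fin (2 ^ (k + 2)) =>
    C.exists_nodePoly (sampleSet h) hs hC C.output
  have hdeg : ∀ h, (p h).totalDegree ≤ (r * (k + 1)) ^ d := fun h =>
    (hpdeg h).trans (hR ▸ Nat.pow_le_pow_right (hR ▸ hRpos) hd)
  have hmono : (2 * (s : ℝ)) ^ (2 * Fintype.card (Fin r × Fin (k + 1))) ^ C.nodeDepth C.output ≤
      (2 * s) ^ (2 * (r * (k + 1))) ^ d := by
    rw [hR]
    exact pow_le_pow_right₀ (by linarith) (Nat.pow_le_pow_right (by omega) hd)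
  choose M hMdeg hMnorm hMcorr using
    fun ω : Fin l → Fin r → Fin C.size → Fin (2 ^ (k + 2)) =>
    exists_majorityPoly (fun i => p (ω i)) (B := (2 * s) ^ (2 * (r * (k + 1))) ^ d) (by positivity)
      (fun i => hdeg (ω i)) (fun i a => (hpnorm (ω i) a).1.trans hmono)
      (fun i a => (hpnorm (ω i) a).2.trans hmono)
  refine ⟨fun ω => (M ω, E ω), fun a => ?_, fun ω a hωa => ?_, fun ω => ⟨hMdeg ω, hMnorm ω, ?_⟩⟩
  -- If the witness fires, the approximate majority rejects, so more than a 1/(2t) fraction of the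
  -- samples has a bad gate.
  · refine (prob_mono fun ω hω => ?_).trans (prob_many_le (fun h => Q h a) l
      ((prob_exists_bad_le (hC.trans hk) r a d).trans hrt))
    by_contra! H
    refine (hEeval ω a).1 hω ((hidx (G ω a)).2 (le_of_eq_of_le ?_ H))
    congr 2
    ext i
    simp [G]
  -- If the witness is silent, more than half of the samples are good, and the majority polynomial
  -- returns their common value.
  · refine hMcorr ω a _ (G ω a) (fun i hi => ?_) ?_
    · refine hpcorr (ω i) a fun u hu hbad => (Finset.mem_filter.1 hi).2 ⟨⟨u, hu.trans hd⟩, hbad⟩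
    · by_contra! H
      refine (hidx (G ω a)).1 H ?_
      by_contra H'
      have := (hEeval ω a).2 H'
      rw [this] at hωa
      exact Bool.noConfusion hωa
  · exact ⟨(hEmem ω).1.trans (by gcongr), (hEmem ω).2⟩

end Circuit

/-! ### From random samples to a PPW; the easy ranges of ε -/

/-- A pair that depends on a uniformly distributed parameter is a PPW if the witness fires with
probability at most `ε`. -/
theorem exists_isPPW_of_prob {n : ℕ} (C : Circuit n) {ε : ℝ} {Ω : Type*} [Fintype Ω] [Nonempty Ω]
    (f : Ω → MvPolynomial (Fin n) ℝ × Circuit n)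
    (hε : ∀ a, prob (fun ω => (f ω).2.eval a = true) ≤ ε)
    (hf : ∀ ω a, (f ω).2.eval a = false → evalCube (f ω).1 a = bit (C.eval a))
    {Q : MvPolynomial (Fin n) ℝ × Circuit n → Prop} (hQ : ∀ ω, Q (f ω)) :
    ∃ μ : PMF (MvPolynomial (Fin n) ℝ × Circuit n), IsPPW C ε μ ∧ ∀ x ∈ μ.support, Q x := by
  classical
  refine ⟨(PMF.uniformOfFintype Ω).map f, ⟨fun a => ?_, fun x hx a hxa => ?_⟩, fun x hx => ?_⟩
  · rw [PMF.toOuterMeasure_map_apply, PMF.toOuterMeasure_uniformOfFintype_apply]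
    have := hε a
    rw [prob_eq] at this
    refine le_trans (le_of_eq ?_) (ENNReal.ofReal_le_ofReal this)
    rw [ENNReal.ofReal_div_of_pos (by exact_mod_cast Fintype.card_pos), ENNReal.ofReal_natCast,
      ENNReal.ofReal_natCast, Fintype.card_subtype]
    congr!
  · obtain ⟨ω, -, rfl⟩ := (PMF.mem_support_map_iff _ _ _).1 hx
    exact hf ω a hxa
  · obtain ⟨ω, -, rfl⟩ := (PMF.mem_support_map_iff _ _ _).1 hx
    exact hQ ω

theorem cubeNorm_le {n : ℕ} {P : MvPolynomial (Fin n) ℝ} {B : ℝ} (h : ∀ a, |evalCube P a| ≤ B) :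
    cubeNorm P ≤ B := ciSup_le h

theorem abs_bit_le_one (b : Bool) : |bit b| ≤ 1 := by cases b <;> simp [bit]

/-- The circuit that consists of the constant `0`. -/
def Circuit.zero (n : ℕ) : Circuit n := ⟨1, fun _ => .const false, 0⟩

theorem Circuit.zero_mem_AC0 {n s d : ℕ} (hs : 1 ≤ s) : Circuit.zero n ∈ AC0 n s d := by
  refine ⟨hs, ?_⟩
  rw [Circuit.depth, Circuit.nodeDepth.eq_1]
  exact Nat.zero_le _

theorem Circuit.zero_eval {n : ℕ} (a : Fin n → Bool) : (Circuit.zero n).eval a = false := by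
  rw [Circuit.eval, Circuit.value.eq_1]
  rfl

/-- A polynomial that is correct everywhere needs only the witness that never fires. -/
theorem exists_isPPW_of_exact {n s d d' : ℕ} {ε X : ℝ} (C : Circuit n) (hε : 0 ≤ ε) (hX : 1 ≤ X)
    (hs : 1 ≤ s) (h : ∃ p : MvPolynomial (Fin n) ℝ, (p.totalDegree : ℝ) ≤ X ∧
      ∀ a, evalCube p a = bit (C.eval a)) :
    ∃ μ : PMF (MvPolynomial (Fin n) ℝ × Circuit n), IsPPW C ε μ ∧
      ∀ x ∈ μ.support, (x.1.totalDegree : ℝ) ≤ X ∧ cubeNorm x.1 ≤ Real.exp X ∧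
        x.2 ∈ AC0 n s (d + d') := by
  obtain ⟨p, hd, hp⟩ := h
  refine exists_isPPW_of_prob C (fun _ : Unit => (p, Circuit.zero n)) (fun a => ?_)
    (fun _ a _ => hp a) fun _ => ⟨hd, cubeNorm_le fun a => ?_, Circuit.zero_mem_AC0 hs⟩
  · simpa [prob, Circuit.zero_eval] using hε
  · rw [hp]
    exact (abs_bit_le_one _).trans (Real.one_le_exp (by linarith))

/-- With error at least `1 / 2`, a random constant will do. -/
theorem exists_isPPW_of_half_le {n s d : ℕ} {ε X : ℝ} {C : Circuit n} (hC : C ∈ AC0 n s d)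
    (hε : 1 / 2 ≤ ε) (hX : 0 ≤ X) :
    ∃ μ : PMF (MvPolynomial (Fin n) ℝ × Circuit n), IsPPW C ε μ ∧
      ∀ x ∈ μ.support, (x.1.totalDegree : ℝ) ≤ X ∧ cubeNorm x.1 ≤ Real.exp X ∧
        x.2 ∈ AC0 n (s + 1) d := by
  have hcost : C.Cost 0 d fun a => C.eval a = true := (Circuit.computes_value hC.2).cost
  -- For a uniform bit b, the witness tests C(a) ≠ b. Constant polynomials are required here, since
  -- the degree bound is 0 when ε = 1.
  have key : ∀ b : Bool, ∃ E ∈ AC0 n (C.size + 1) d, ∀ a, E.eval a = true ↔ C.eval a ≠ b := by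
    rintro (_ | _)
    · simpa using (hcost.mono (zero_le_one' ℕ) le_rfl).exists_circuit
    · simpa using hcost.not.exists_circuit
  choose E hE hEval using key
  refine exists_isPPW_of_prob C (fun b : Bool => (.C (bit b), E b)) (fun a => ?_)
    (fun b a hb => ?_) fun b => ⟨by simpa using hX, cubeNorm_le fun a => ?_, ?_⟩
  · rw [prob_eq]
    simp only [hEval]
    refine le_trans (le_of_eq ?_) hε
    cases C.eval a <;> simp [Finset.filter_insert, Finset.filter_singleton]
  · have : ¬ C.eval a ≠ b := fun h => by simp [(hEval b a).2 h] at hb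
    rw [not_not.1 this]
    simp [evalCube]
  · simpa [evalCube] using (abs_bit_le_one b).trans (Real.one_le_exp hX)
  · exact ⟨(hE b).1.trans (Nat.add_le_add_right hC.1 1), (hE b).2⟩

/-! ### Numerical estimates and the main range -/

/-- It comes from 3^2 ≥ 2^3. A bound strictly above 1 lets powers of log s absorb constants, which
is impossible at s = 2. -/
theorem three_halves_le_logb {s : ℕ} (hs : 3 ≤ s) : 3 / 2 ≤ Real.logb 2 s := by
  rw [Real.le_logb_iff_rpow_le (by norm_num) (by positivity)]
  have h3 : (3 : ℝ) ≤ s := by exact_mod_cast hs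
  refine le_trans (le_trans ?_ (Real.sqrt_le_sqrt (by norm_num : (8 : ℝ) ≤ 9))) ?_
  · rw [Real.sqrt_eq_rpow, show (8 : ℝ) = 2 ^ (3 : ℝ) by norm_num, ← Real.rpow_mul (by norm_num)]
    norm_num
  · rw [show (9 : ℝ) = 3 ^ 2 by norm_num, Real.sqrt_sq (by norm_num)]
    exact h3

theorem clog_le_logb_add_one {s : ℕ} (hs : 2 ≤ s) : (Nat.clog 2 s : ℝ) ≤ Real.logb 2 s + 1 := by
  have h := Nat.pow_pred_clog_lt_self (b := 2) (by norm_num) hs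
  have h' : ((Nat.clog 2 s).pred : ℝ) ≤ Real.logb 2 s := by
    rw [Real.le_logb_iff_rpow_le (by norm_num) (by positivity), Real.rpow_natCast]
    exact_mod_cast h.le
  have h'' : (Nat.clog 2 s : ℝ) ≤ (Nat.clog 2 s).pred + 1 := by
    exact_mod_cast (by rw [Nat.pred_eq_sub_one]; omega : Nat.clog 2 s ≤ (Nat.clog 2 s).pred + 1)
  linarith

theorem witness_size_le {s l k : ℕ} (hs : 3 ≤ s) (hl : l ≤ s) (hk : k ≤ s) :
    s + ((l + 2) * ((2 * l + 4) * ((k + 4) *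
      (27 * (6 * (5 * k + 16) * (k + 1)) * s ^ 3) + 1) + 1) + 2) ≤ s ^ 24 := by
  -- Each additive constant is paid for by one more factor s ≥ 3.
  have hadd : ∀ {x i : ℕ}, x ≤ s ^ i → x + 2 ≤ s ^ (i + 1) := fun {x i} hx => by
    have : 1 ≤ s ^ i := Nat.one_le_pow _ _ (by omega)
    rw [pow_succ]
    nlinarith
  have h27 : 27 ≤ s ^ 3 := by
    calc 27 = 3 ^ 3 := by norm_num
      _ ≤ s ^ 3 := Nat.pow_le_pow_left hs 3
  have h132 : 132 ≤ s ^ 5 := by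
    calc 132 ≤ 3 ^ 5 := by norm_num
      _ ≤ s ^ 5 := Nat.pow_le_pow_left hs 5
  have hR : 6 * (5 * k + 16) * (k + 1) ≤ s ^ 7 := by
    calc 6 * (5 * k + 16) * (k + 1) ≤ 6 * (11 * s) * (2 * s) := by gcongr <;> omega
      _ = 132 * s ^ 2 := by ring
      _ ≤ s ^ 5 * s ^ 2 := by gcongr
      _ = s ^ 7 := by ring
  have h1 : (k + 4) * (27 * (6 * (5 * k + 16) * (k + 1)) * s ^ 3) + 1 ≤ s ^ 16 := by
    refine le_trans (Nat.le_succ _) (hadd (i := 15) ?_)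
    calc _ ≤ s ^ 2 * (s ^ 3 * s ^ 7 * s ^ 3) := by gcongr; nlinarith
      _ = s ^ 15 := by ring
  have h2 : (2 * l + 4) * ((k + 4) * (27 * (6 * (5 * k + 16) * (k + 1)) * s ^ 3) + 1) + 1
      ≤ s ^ 20 := by
    refine le_trans (Nat.le_succ _) (hadd (i := 19) ?_)
    have h4 : 4 * s ≤ s ^ 3 := by
      rw [pow_succ]
      nlinarith [Nat.pow_le_pow_left hs 2]
    calc _ ≤ s ^ 3 * s ^ 16 := by gcongr; omega
      _ = s ^ 19 := by ring
  have h3 : (l + 2) * ((2 * l + 4) * ((k + 4) *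
      (27 * (6 * (5 * k + 16) * (k + 1)) * s ^ 3) + 1) + 1) + 2 ≤ s ^ 23 := by
    refine hadd (i := 22) ?_
    calc _ ≤ s ^ 2 * s ^ 20 := by gcongr; nlinarith
      _ = s ^ 22 := by ring
  have h4 : s ≤ s ^ 23 := Nat.le_self_pow (by norm_num) s
  calc _ ≤ s ^ 23 + s ^ 23 := add_le_add h4 h3
    _ ≤ s ^ 24 := by rw [pow_succ _ 23]; nlinarith [Nat.one_le_pow 23 s (by omega)]

/-- Six repetitions at least halve the error, as (7/8)^6 ≤ 1/2, and 5k + 16 = k + 4(k + 4): the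
first k halvings cancel the union bound over the gates. -/
theorem seven_eighths_pow_le (k : ℕ) :
    (2 : ℝ) ^ k * (7 / 8) ^ (6 * (5 * k + 16)) ≤ (1 / 2) ^ (4 * (k + 4)) := by
  calc (2 : ℝ) ^ k * (7 / 8) ^ (6 * (5 * k + 16))
      = 2 ^ k * ((7 / 8) ^ 6) ^ (5 * k + 16) := by rw [pow_mul]
    _ ≤ 2 ^ k * (1 / 2) ^ (5 * k + 16) := by gcongr; norm_num
    _ = (2 * (1 / 2)) ^ k * (1 / 2) ^ (4 * (k + 4)) := by rw [mul_pow]; ring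
    _ = (1 / 2) ^ (4 * (k + 4)) := by norm_num

/-- Left is the per-level cost in the norm estimate; the constant is 3192 ≤ (3/2)^20. -/
theorem sample_count_le {k : ℕ} {ℓ : ℝ} (hℓ : 3 / 2 ≤ ℓ) (hk : (k : ℝ) ≤ ℓ + 1) :
    12 * ((6 * (5 * k + 16) * (k + 1) : ℕ) : ℝ) * ℓ ≤ ℓ ^ 23 := by
  push_cast
  have h1 : 5 * (k : ℝ) + 16 ≤ 19 * ℓ := by linarith
  have h2 : (k : ℝ) + 1 ≤ 7 / 3 * ℓ := by linarith
  calc 12 * (6 * (5 * (k : ℝ) + 16) * (k + 1)) * ℓ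
      ≤ 12 * (6 * (19 * ℓ) * (7 / 3 * ℓ)) * ℓ := by gcongr
    _ = 3192 * ℓ ^ 3 := by ring
    _ ≤ (3 / 2) ^ 20 * ℓ ^ 3 := by gcongr; norm_num
    _ ≤ ℓ ^ 20 * ℓ ^ 3 := by gcongr
    _ = ℓ ^ 23 := by ring

/-- With l = ⌈L⌉ samples the error is 2^(-l) ≤ ε. From L > 1 follows l ≤ 2L, and from L < s follows
l ≤ s, which keeps the witness polynomial in s alone. -/
theorem exists_isPPW_of_lt {n s d : ℕ} {ε L : ℝ} {C : Circuit n} (hs : 3 ≤ s) (hd : d ≠ 0)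
    (hC : C ∈ AC0 n s d) (hL1 : 1 < L) (hLs : L < s) (hε : (1 / 2) ^ L = ε) :
    ∃ μ : PMF (MvPolynomial (Fin n) ℝ × Circuit n), IsPPW C ε μ ∧
      ∀ x ∈ μ.support, (x.1.totalDegree : ℝ) ≤ (Real.logb 2 s) ^ (24 * d) * L ∧
        cubeNorm x.1 ≤ Real.exp ((Real.logb 2 s) ^ (24 * d) * L) ∧
        x.2 ∈ AC0 n (s ^ 24) (d + 24) := by
  set ℓ := Real.logb 2 s with hℓdef
  have hℓ : 3 / 2 ≤ ℓ := three_halves_le_logb hs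
  set k := Nat.clog 2 s
  have hkℓ : (k : ℝ) ≤ ℓ + 1 := clog_le_logb_add_one (by omega)
  have hk : s ≤ 2 ^ k := Nat.le_pow_clog (by norm_num) s
  have hks : k ≤ s := Nat.clog_le_of_le_pow Nat.lt_two_pow_self.le
  set l := ⌈L⌉₊
  have hLl : L ≤ l := Nat.le_ceil L
  have hl0 : 0 < l := Nat.ceil_pos.2 (by linarith)
  have hlL : (l : ℝ) ≤ 2 * L := by
    have := (Nat.ceil_lt_add_one (by linarith : 0 ≤ L)).le
    linarith
  have hls : l ≤ s := Nat.ceil_le.2 hLs.le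
  set R := 6 * (5 * k + 16) * (k + 1)
  have hR : 12 * (R : ℝ) * ℓ ≤ ℓ ^ 23 := sample_count_le hℓ hkℓ
  have hR1 : (1 : ℝ) ≤ R := by
    have : 0 < R := by positivity
    exact_mod_cast this
  have hRd : (12 * (R : ℝ) * ℓ) ^ d ≤ ℓ ^ (24 * d) := by
    calc (12 * (R : ℝ) * ℓ) ^ d ≤ (ℓ ^ 23) ^ d := by gcongr
      _ = ℓ ^ (23 * d) := by rw [pow_mul]
      _ ≤ ℓ ^ (24 * d) := pow_le_pow_right₀ (by linarith) (by omega)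
  -- The choice t = k + 4 gives 2^t = 16 · 2^k ≥ 4l + 8, because l ≤ s ≤ 2^k.
  obtain ⟨f, hf1, hf2, hf3⟩ := Circuit.exists_sampled_ppw (k := k) (l := l) (t := k + 4)
    (r := 6 * (5 * k + 16)) (by omega) hC.1 hC.2 hk hl0 (by rw [pow_add]; omega) (by positivity)
    (seven_eighths_pow_le k)
  refine exists_isPPW_of_prob C f (fun a => (hf1 a).trans ?_) hf2 fun ω => ?_
  · rw [← hε, ← Real.rpow_natCast]
    exact Real.rpow_le_rpow_of_exponent_ge (by norm_num) (by norm_num) hLl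
  obtain ⟨hdeg, hnorm, hmem⟩ := hf3 ω
  refine ⟨?_, cubeNorm_le fun a => (hnorm a).trans ?_, ?_⟩
  -- Constant factors fit into d-th powers only because d ≠ 0.
  · have h2 : (2 : ℝ) ≤ 2 ^ d := by
      simpa using pow_le_pow_right₀ (by norm_num : (1 : ℝ) ≤ 2) (Nat.one_le_iff_ne_zero.2 hd)
    calc ((f ω).1.totalDegree : ℝ) ≤ l * (R : ℝ) ^ d := by exact_mod_cast hdeg
      _ ≤ 2 * L * (R : ℝ) ^ d := by gcongr
      _ ≤ 2 ^ d * L * (R : ℝ) ^ d := by gcongr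
      _ = (2 * R) ^ d * L := by rw [mul_pow]; ring
      _ ≤ (12 * (R : ℝ) * ℓ) ^ d * L := by gcongr ?_ ^ d * L; nlinarith
      _ ≤ ℓ ^ (24 * d) * L := by gcongr
  · set X : ℕ := (2 * R) ^ d with hX
    have hX1 : (1 : ℝ) ≤ X := by
      have : 0 < X := by positivity
      exact_mod_cast this
    have h2 : (2 : ℝ) ≤ Real.exp 1 := by
      have := Real.add_one_le_exp (1 : ℝ)
      linarith
    have hs0 : (0 : ℝ) < s := by positivity
    have hsexp : (s : ℝ) ≤ Real.exp ℓ := by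
      have h : Real.log s ≤ ℓ := by
        rw [hℓdef, ← Real.log_div_log]
        refine le_div_self (Real.log_nonneg (by exact_mod_cast (by omega : 1 ≤ s)))
          (Real.log_pos (by norm_num)) ?_
        have := Real.log_two_lt_d9
        linarith
      calc (s : ℝ) = Real.exp (Real.log s) := (Real.exp_log hs0).symm
        _ ≤ Real.exp ℓ := Real.exp_le_exp.2 h
    have h6 : (6 : ℝ) * ℓ ≤ (6 * ℓ) ^ d := le_self_pow₀ (by linarith) hd
    calc ((2 : ℝ) * (2 * s) ^ X) ^ l
        ≤ (Real.exp 1 * (Real.exp 1 * Real.exp ℓ) ^ X) ^ l := by gcongr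
      _ = Real.exp (l * (1 + X * (1 + ℓ))) := by
        rw [← Real.exp_add, ← Real.exp_nat_mul, ← Real.exp_add, ← Real.exp_nat_mul]
      _ ≤ Real.exp (ℓ ^ (24 * d) * L) := by
        refine Real.exp_le_exp.2 ?_
        calc (l : ℝ) * (1 + X * (1 + ℓ)) ≤ 2 * L * (X * ℓ + X * (2 * ℓ)) := by
              gcongr <;> nlinarith
          _ = 6 * ℓ * X * L := by ring
          _ ≤ (6 * ℓ) ^ d * X * L := by gcongr
          _ = (12 * (R : ℝ) * ℓ) ^ d * L := by
            rw [hX]; push_cast; rw [← mul_pow]; ring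
          _ ≤ ℓ ^ (24 * d) * L := by gcongr
  · exact ⟨hmem.1.trans (witness_size_le hs hls hks), hmem.2.trans (by omega)⟩

/-- A circuit of depth `0` is computed exactly by a polynomial of degree at most `1`. -/
theorem Circuit.exists_exactPoly_of_depth_zero {n : ℕ} (C : Circuit n) (hC : C.depth = 0) :
    ∃ p : MvPolynomial (Fin n) ℝ, p.totalDegree ≤ 1 ∧ ∀ a, evalCube p a = bit (C.eval a) := by
  -- At depth 0 no gate can be bad, so any family of sets will do; a family with one member makes
  -- the degree bound 1.
  obtain ⟨p, hd, -, hp⟩ := C.exists_nodePoly (K := Unit) (fun _ _ => True)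
    (Nat.le_add_left 2 C.size) (Nat.le_add_right _ _) C.output
  refine ⟨p, by simpa using hd, fun a => hp a fun u hu hbad => ?_⟩
  have := hbad.nodeDepth_pos
  rw [Circuit.depth] at hC
  omega

/-! ### The theorem: division into ranges of log(1/ε) -/

theorem lemma2p6 :
    ∃ c : ℕ, ∀ (n s d : ℕ) (ε : ℝ), 2 ≤ s → 0 < ε → ε ≤ 1 →
      ∀ C ∈ AC0 n s d,
        ∃ μ : PMF (MvPolynomial (Fin n) ℝ × Circuit n),
          IsPPW C ε μ ∧
          ∀ x ∈ μ.support,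
            (x.1.totalDegree : ℝ) ≤ (Real.logb 2 s) ^ (c * d) * Real.logb 2 (1 / ε) ∧
            cubeNorm x.1 ≤ Real.exp ((Real.logb 2 s) ^ (c * d) * Real.logb 2 (1 / ε)) ∧
            x.2 ∈ AC0 n ⌊((s : ℝ) * max 1 (Real.logb 2 (1 / ε))) ^ c⌋₊ (d + c) := by
  -- The value 24 is set by the witness size; the degree and the norm would allow 23.
  refine ⟨24, fun n s d ε hs hε0 hε1 C hC => ?_⟩
  set L := Real.logb 2 (1 / ε) with hL
  have hL0 : 0 ≤ L := Real.logb_nonneg (by norm_num) (by rwa [le_div_iff₀ hε0, one_mul])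
  have hεL : (1 / 2 : ℝ) ^ L = ε := by
    rw [one_div, Real.inv_rpow (by norm_num), hL,
      Real.rpow_logb (by norm_num) (by norm_num) (by positivity), one_div, inv_inv]
  have hs2 : (2 : ℝ) ≤ s := by exact_mod_cast hs
  have hlog : 1 ≤ Real.logb 2 s := by
    rw [Real.le_logb_iff_rpow_le (by norm_num) (by positivity), Real.rpow_one]
    exact hs2
  have hpow : 1 ≤ Real.logb 2 s ^ (24 * d) := one_le_pow₀ hlog
  have hsize : s ^ 24 ≤ ⌊((s : ℝ) * max 1 L) ^ 24⌋₊ := by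
    refine Nat.le_floor ?_
    push_cast
    gcongr
    exact le_mul_of_one_le_right (by positivity) (le_max_left _ _)
  have hs1 : s + 1 ≤ s ^ 24 := by
    calc s + 1 ≤ s ^ 2 := by nlinarith
      _ ≤ s ^ 24 := Nat.pow_le_pow_right (by omega) (by norm_num)
  have hAC0 : ∀ {s' d' : ℕ} {E : Circuit n}, s' ≤ s ^ 24 → d' ≤ d + 24 → E ∈ AC0 n s' d' →
      E ∈ AC0 n ⌊((s : ℝ) * max 1 L) ^ 24⌋₊ (d + 24) := fun h h' hE =>
    ⟨hE.1.trans (h.trans hsize), hE.2.trans h'⟩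
  by_cases hL1 : L ≤ 1
  · have hhalf : 1 / 2 ≤ ε := by
      rw [← hεL]
      simpa using Real.rpow_le_rpow_of_exponent_ge (by norm_num : (0 : ℝ) < 1 / 2)
        (by norm_num) hL1
    obtain ⟨μ, hμ, h⟩ := exists_isPPW_of_half_le hC hhalf
      (mul_nonneg (zero_le_one.trans hpow) hL0)
    exact ⟨μ, hμ, fun x hx => ⟨(h x hx).1, (h x hx).2.1, hAC0 hs1 (by omega) (h x hx).2.2⟩⟩
  push Not at hL1
  have hX : L ≤ Real.logb 2 s ^ (24 * d) * L := le_mul_of_one_le_left hL0 hpow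
  by_cases hexact : ∃ p : MvPolynomial (Fin n) ℝ, (p.totalDegree : ℝ) ≤ L ∧
      ∀ a, evalCube p a = bit (C.eval a)
  · obtain ⟨p, hp, hp'⟩ := hexact
    obtain ⟨μ, hμ, h⟩ := exists_isPPW_of_exact (d := d) (d' := 24) C hε0.le (hL1.le.trans hX)
      (by omega : 1 ≤ s ^ 24) ⟨p, hp.trans hX, hp'⟩
    exact ⟨μ, hμ, fun x hx => ⟨(h x hx).1, (h x hx).2.1, hAC0 le_rfl le_rfl (h x hx).2.2⟩⟩
  have hd : d ≠ 0 := by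
    rintro rfl
    obtain ⟨p, hp, hp'⟩ := C.exists_exactPoly_of_depth_zero (Nat.le_zero.1 hC.2)
    exact hexact ⟨p, le_trans (by exact_mod_cast hp) hL1.le, hp'⟩
  obtain ⟨p, hp, hp'⟩ := C.exists_exactPoly
  -- Otherwise the exact polynomial in all variables would have degree at most L. Together with L >
  -- 1 this forces s ≥ 3.
  have hlt : L < (max 1 (s - 1) : ℕ) := by
    by_contra! H
    refine hexact ⟨p, le_trans ?_ H, hp'⟩
    exact_mod_cast hp.trans (max_le_max le_rfl (Nat.sub_le_sub_right hC.1 1))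
  have hs3 : 3 ≤ s := by
    by_contra! H
    have : max 1 (s - 1) = 1 := by omega
    rw [this, Nat.cast_one] at hlt
    exact lt_asymm hlt hL1
  have hLs : L < s := hlt.trans_le (by exact_mod_cast (by omega : max 1 (s - 1) ≤ s))
  obtain ⟨μ, hμ, h⟩ := exists_isPPW_of_lt hs3 hd hC hL1 hLs hεL
  exact ⟨μ, hμ, fun x hx => ⟨(h x hx).1, (h x hx).2.1, hAC0 le_rfl le_rfl (h x hx).2.2⟩⟩
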